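/- Let $\mathbb P^2=\mathbb P(\mathbb R^3)$, with $\mathbb R^2\subset\mathbb P^2$ via $(a,b)\mapsto[a:b:1]$, and let $\mathrm{PGL}(3,\mathbb R)$ act on $\mathbb P^2$. A nonempty open set $\omega\subset\mathbb P^2$ is *properly convex* if some projective line does not meet its closure and $\omega$ is convex in the affine plane complementary to that line; it then carries the Hilbert distance $d_\omega(p,q)=\frac12\ln[a,p,q,b]$ for $p\ne q$, where $a,p,q,b$ are the consecutive points in which the line $pq$ meets $\partial\omega$, and $p,q$. For $\delta>0$ call $\omega$ *$\delta$-hyperbolic* if in every geodesic triangle of $(\omega,d_\omega)$ each point of a side is at distance at most $\delta$ from the union of the other two sides. Let $T_2^\delta$ be the set of all $(\omega,x,y,z)$ with $\omega\subset\mathbb P^2$ nonempty, open, properly convex and $\delta$-hyperbolic and $x,y,z\in\partial\omega$ pairwise distinct. Convergence of sets is in the Hausdorff distance of $\mathbb P^2$. A line $\ell$ is *tangent* to $\partial\omega$ at $p\in\partial\omega\cap\ell$ if $\ell$ is the unique projective line through $p$ that does not meet $\omega$. **Theorem.** Let $\delta>0$ and let $(\omega_n,x_n,y_n,z_n)_{n\in\mathbb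 N}$ be any sequence in $T_2^\delta$. (0) $\mathrm{PGL}(3,\mathbb R)$ acts cocompactly on $T_2^\delta$, i.e. there are $g_n\in\mathrm{PGL}(3,\mathbb R)$ such that a subsequence of $(g_n\omega_n,g_nx_n,g_ny_n,g_nz_n)$ converges to an element $(\omega,x,y,z)$ of $T_2^\delta$. (1) There are $g_n\in\mathrm{PGL}(3,\mathbb R)$ and a number $0<e\le 1/2$ such that for every $n$ there is $\alpha_n\in[e,1/2]$ with: $\{g_nx_n,g_ny_n,g_nz_n\}=\{(1,0),(0,1),(1,1)\}$; $g_n\omega_n\subset\mathbb R^+\times\mathbb R^+$; and $\partial(g_n\omega_n)$ is tangent at $(1,0)$ to the $x$-axis, at $(0,1)$ to the $y$-axis, and at $(1,1)$ to the line through $(1/\alpha_n,0)$ and $(0,1/(1-\alpha_n))$. (2) For any $(g_n)$ and $e$ as in (1), a subsequence of $(g_n\omega_n)$ converges in Hausdorff distance to some $\omega$ with $(\omega,(1,0),(0,1),(1,1))\in T_2^\delta$. -/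

import Mathlib

open Filter Topology
open scoped LinearAlgebra.Projectivization MatrixGroups Pointwise

/-- The real projective plane `ℙ(ℝ³)`. -/
abbrev P2 : Type := ℙ ℝ (Fin 3 → ℝ)

/-- The embedding of the projective plane into the `3 × 3` real matrices that sends the line
spanned by `v` to the matrix `v vᵀ / (v ⬝ v)` of the orthogonal projection onto it. -/
noncomputable def projectionMatrix : P2 → EuclideanSpace ℝ (Fin 3 × Fin 3) :=
  Projectivization.lift
    (fun v => WithLp.toLp 2 (fun ij => v.1 ij.1 * v.1 ij.2 / (v.1 ⬝ᵥ v.1)))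
    (by
      rintro ⟨a, ha⟩ ⟨b, hb⟩ t h
      simp only at h
      subst h
      have ht : t ≠ 0 := by
        rintro rfl
        simp at ha
      ext ij
      simp only [dotProduct_smul, smul_dotProduct, Pi.smul_apply, smul_eq_mul]
      have : b ⬝ᵥ b ≠ 0 := by simpa [dotProduct_self_eq_zero] using hb
      field_simp)

theorem projectionMatrix_injective : Function.Injective projectionMatrix := by
  intro p q h
  induction p using Projectivization.ind with | h v hv =>
  induction q using Projectivization.ind with | h w hw =>
  have hv' : v ⬝ᵥ v ≠ 0 := by simpa [dotProduct_self_eq_zero] using hv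
  rw [Projectivization.mk_eq_mk_iff']
  refine ⟨(w ⬝ᵥ v) / (w ⬝ᵥ w), ?_⟩
  ext i
  have hij : ∀ j, v i * v j / (v ⬝ᵥ v) = w i * w j / (w ⬝ᵥ w) := fun j =>
    congrArg (fun m : EuclideanSpace ℝ (Fin 3 × Fin 3) => m (i, j)) h
  have key : ∀ (c n : ℝ) (u t : Fin 3 → ℝ), ∑ j, c * u j / n * t j = c / n * (u ⬝ᵥ t) := by
    intro c n u t
    rw [dotProduct, Finset.mul_sum]
    exact Finset.sum_congr rfl fun j _ => by ring
  have h1 : ∑ j, v i * v j / (v ⬝ᵥ v) * v j = v i := by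
    rw [key, div_mul_cancel₀ _ hv']
  have h2 : ∑ j, w i * w j / (w ⬝ᵥ w) * v j = (w ⬝ᵥ v) / (w ⬝ᵥ w) * w i := by
    rw [key]
    ring
  simp only [Pi.smul_apply, smul_eq_mul]
  rw [← h1, ← h2]
  exact Finset.sum_congr rfl fun j _ => by rw [hij j]

/-- The projective plane with (up to the factor `√2`) the distance `sin ∠(p, q)`, which induces
its usual topology. -/
noncomputable instance : MetricSpace P2 :=
  MetricSpace.induced projectionMatrix projectionMatrix_injective inferInstance

/-- The point `(a, b)` of the standard affine chart `ℝ² ⊂ ℙ(ℝ³)`. -/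
noncomputable def affinePoint (a b : ℝ) : P2 :=
  Projectivization.mk ℝ ![a, b, 1] (fun h => by simpa using congrFun h 2)

/-- The projective line through two distinct points `p` and `q`. -/
def lineThrough (p q : P2) : Set P2 :=
  {r | r.submodule ≤ p.submodule ⊔ q.submodule}

/-- The part of `ω` in the affine plane `{f = 1}`, which is the affine chart of the projective
plane whose line at infinity is the projective line `{f = 0}`. -/
def chartSlice (ω : Set P2) (f : Module.Dual ℝ (Fin 3 → ℝ)) : Set (Fin 3 → ℝ) :=
  {v | f v = 1 ∧ ∃ hv : v ≠ 0, Projectivization.mk ℝ v hv ∈ ω}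

/-- `f` is an affine chart in which `ω` is a (bounded) convex set: the projective line `{f = 0}`
does not meet the closure of `ω`, and `ω` is convex in the affine plane `{f = 1}`. -/
structure IsConvexChart (ω : Set P2) (f : Module.Dual ℝ (Fin 3 → ℝ)) : Prop where
  ne_zero : f ≠ 0
  avoids : ∀ p ∈ closure ω, f p.rep ≠ 0
  convex : Convex ℝ (chartSlice ω f)

section Hilbert

variable {E : Type*} [NormedAddCommGroup E] [NormedSpace ℝ E]

/-- The end of the chord of `C` through `p` and `q` that lies on the side of `p`. -/
noncomputable def chordStart (C : Set E) (p q : E) : E :=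
  AffineMap.lineMap p q (sInf {t : ℝ | AffineMap.lineMap p q t ∈ C})

/-- The end of the chord of `C` through `p` and `q` that lies on the side of `q`. -/
noncomputable def chordEnd (C : Set E) (p q : E) : E :=
  AffineMap.lineMap p q (sSup {t : ℝ | AffineMap.lineMap p q t ∈ C})

open Classical in
/-- The Hilbert distance `½ log [a, p, q, b]` of a bounded convex domain `C`, where `a, p, q, b` are
the consecutive points in which the line through `p` and `q` meets `∂C`, and `p`, `q`. The four
points are collinear, so the cross-ratio does not depend on the choice of the norm. -/
noncomputable def hilbertDist (C : Set E) (p q : E) : ℝ :=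
  if p = q then 0 else
    1 / 2 * Real.log
      ((dist q (chordStart C p q) / dist p (chordStart C p q)) *
        (dist p (chordEnd C p q) / dist q (chordEnd C p q)))

/-- `S` is a geodesic segment of the Hilbert geometry of `C` from `x` to `y`: the image of an
isometric map from a compact interval. -/
def IsHilbertGeodesic (C : Set E) (S : Set E) (x y : E) : Prop :=
  ∃ (l : ℝ) (γ : ℝ → E), 0 ≤ l ∧ γ 0 = x ∧ γ l = y ∧ S = γ '' Set.Icc 0 l ∧ S ⊆ C ∧
    ∀ s ∈ Set.Icc 0 l, ∀ t ∈ Set.Icc 0 l, hilbertDist C (γ s) (γ t) = |s - t|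

/-- The Hilbert geometry of `C` is `δ`-hyperbolic: in every geodesic triangle, each point of a side
is at distance at most `δ` from the union of the two other sides. -/
def IsHilbertHyperbolic (δ : ℝ) (C : Set E) : Prop :=
  ∀ (x y z : E) (A B S : Set E), IsHilbertGeodesic C A y z → IsHilbertGeodesic C B z x →
    IsHilbertGeodesic C S x y → ∀ p ∈ S, ∃ q ∈ A ∪ B, hilbertDist C p q ≤ δ

end Hilbert

/-- The set `X₂` of nonempty properly convex open subsets of the projective plane. -/
def properlyConvexDomains : Set (Set P2) :=
  {ω | IsOpen ω ∧ ω.Nonempty ∧ ∃ f, IsConvexChart ω f}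

/-- The set `X₂^δ` of properly convex open sets whose Hilbert geometry is `δ`-hyperbolic. The
Hilbert distance is invariant under projective maps, so any affine chart may be used. -/
def hyperbolicDomains (δ : ℝ) : Set (Set P2) :=
  {ω | ω ∈ properlyConvexDomains ∧
    ∃ f, IsConvexChart ω f ∧ IsHilbertHyperbolic δ (chartSlice ω f)}

/-- The set `T₂^δ` of triangle-pointed `δ`-hyperbolic properly convex open sets. -/
def trianglePointed (δ : ℝ) : Set (Set P2 × P2 × P2 × P2) :=
  {T | match T with
    | (ω, x, y, z) =>
      ω ∈ hyperbolicDomains δ ∧ x ∈ frontier ω ∧ y ∈ frontier ω ∧ z ∈ frontier ω ∧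
        x ≠ y ∧ y ≠ z ∧ z ≠ x}

/-- The line `ℓ` is tangent to `∂ω` at `p`: it is the one and only projective line through the
boundary point `p` that does not meet the convex domain `ω`. -/
structure IsTangentAt (ω : Set P2) (ℓ : Set P2) (p : P2) : Prop where
  mem_frontier : p ∈ frontier ω
  mem_line : p ∈ ℓ
  disjoint : Disjoint ℓ ω
  unique : ∀ q, q ≠ p → Disjoint (lineThrough p q) ω → lineThrough p q = ℓ

/-- The triangle-pointed domain `(ω, x, y, z)` is in normal position with parameter `α`: its
triangle has the vertices `(1, 0)`, `(0, 1)`, `(1, 1)`, in some order; `ω` lies in the quadrant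
`ℝ⁺ × ℝ⁺`; and `∂ω` is tangent at `(1, 0)` to the first axis, at `(0, 1)` to the second axis, and at
`(1, 1)` to the line through `(1 / α, 0)` and `(0, 1 / (1 - α))`. -/
structure IsNormalPosition (ω : Set P2) (x y z : P2) (α : ℝ) : Prop where
  vertices : ({x, y, z} : Set P2) = {affinePoint 1 0, affinePoint 0 1, affinePoint 1 1}
  quadrant : ∀ p ∈ ω, ∃ a b : ℝ, 0 ≤ a ∧ 0 ≤ b ∧ p = affinePoint a b
  tangent_fst : IsTangentAt ω (lineThrough (affinePoint 0 0) (affinePoint 1 0)) (affinePoint 1 0)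
  tangent_snd : IsTangentAt ω (lineThrough (affinePoint 0 0) (affinePoint 0 1)) (affinePoint 0 1)
  tangent_diag : IsTangentAt ω
    (lineThrough (affinePoint (1 / α) 0) (affinePoint 0 (1 / (1 - α)))) (affinePoint 1 1)

/-! A properly convex domain is replaced by the open convex cone over it. The order of the cone
determines the Hilbert distance: `exp (2 d(p, q))` is the least product `a * b` such that `a • q -
p` and `b • p - q` lie in the closed cone. Hyperbolicity, tested on straight triangles, thus becomes
`IsThinCone` with `R = exp (2 δ)`. This condition mentions no chart, is invariant under linear
isomorphisms and survives limits, even for triangles whose vertices run into the boundary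
(`IsThinCone.limit`).

Thin cones are strictly convex (`IsSharpCone.eq_of_isThinCone`): if a side of a triangle is pushed
against a boundary segment, the middle of that side moves arbitrarily far from the other two sides.
In dimension three they are also smooth (`IsSharpCone.exists_eq_smul`): zooming in at a corner
produces a thin limit cone which is a sector, and a sector has a boundary segment at infinity.
Strict convexity makes straight segments the only geodesics, so that thinness is equivalent to
hyperbolicity with arbitrary geodesic triangles (`IsSharpCone.isHilbertHyperbolic_iff`).

By strict convexity a supporting line at one of the three boundary points misses the other two. A
projective map therefore brings points and lines to the normal position
(`IsSharpCone.exists_normalization`), with one free parameter `α`; exchanging two vertices turns `α`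
into `1 - α`, whence `α ≤ 1 / 2`. Smoothness turns supporting lines into tangents. The closures of
all normalized cones lie in one closed cone with compact slice and contain the cone over a fixed
triangle, so a subsequence converges to a cone with nonempty interior, again sharp and thin
(`exists_subseq_thinCone`). If the parameters came close to `0`, some limit would be supported by
the line through `(0, 1)` and `(1, 1)`, against strict convexity; this gives the bound `e`
(`exists_parameter_bound`). -/

set_option linter.unusedSectionVars false

/-! ### Sharp cones, thin cones and limits of thin triangles -/

section Cones

variable {V : Type*} [NormedAddCommGroup V] [NormedSpace ℝ V] [FiniteDimensional ℝ V]

/-- `K` is a nonempty open convex cone on which `f` is positive, and `f` vanishes nowhere else on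
the closure of `K` than at the origin. -/
structure IsSharpCone (K : Set V) (f : Module.Dual ℝ V) : Prop where
  isOpen : IsOpen K
  convex : Convex ℝ K
  nonempty : K.Nonempty
  smul_mem : ∀ c : ℝ, 0 < c → ∀ v ∈ K, c • v ∈ K
  pos : ∀ v ∈ K, 0 < f v
  pos_closure : ∀ v ∈ closure K, v ≠ 0 → 0 < f v

/-- In every triangle of the cone `K`, every point of a side is at Hilbert distance at most
`log R / 2` from the union of the other two sides. -/
def IsThinCone (R : ℝ) (K : Set V) : Prop :=
  ∀ x ∈ K, ∀ y ∈ K, ∀ z ∈ K, ∀ p ∈ segment ℝ x y, ∃ q ∈ segment ℝ y z ∪ segment ℝ z x,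
    ∃ a b : ℝ, a * b ≤ R ∧ a • q - p ∈ closure K ∧ b • p - q ∈ closure K

namespace IsSharpCone

variable {K : Set V} {f : Module.Dual ℝ V}

theorem zero_mem_closure (hK : IsSharpCone K f) : (0 : V) ∈ closure K := by
  obtain ⟨v, hv⟩ := hK.nonempty
  have h : Tendsto (fun c : ℝ => c • v) (𝓝[>] 0) (𝓝 0) := by
    have : Tendsto (fun c : ℝ => c • v) (𝓝 0) (𝓝 ((0 : ℝ) • v)) :=
      (continuous_id.smul continuous_const).tendsto 0
    rw [zero_smul] at this
    exact this.mono_left nhdsWithin_le_nhds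
  exact mem_closure_of_tendsto h (by
    filter_upwards [self_mem_nhdsWithin] with c hc using hK.smul_mem c hc v hv)

theorem smul_mem_closure (hK : IsSharpCone K f) {c : ℝ} (hc : 0 ≤ c) {v : V}
    (hv : v ∈ closure K) : c • v ∈ closure K := by
  rcases hc.eq_or_lt with rfl | hc
  · simpa using hK.zero_mem_closure
  · exact map_mem_closure (continuous_const_smul c) hv (hK.smul_mem c hc)

theorem add_mem_closure (hK : IsSharpCone K f) {u v : V} (hu : u ∈ closure K)
    (hv : v ∈ closure K) : u + v ∈ closure K := by
  have h := hK.convex.closure hu hv (by norm_num : (0 : ℝ) ≤ 1 / 2) (by norm_num : (0 : ℝ) ≤ 1 / 2)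
    (by norm_num)
  have h2 := hK.smul_mem_closure (by norm_num : (0 : ℝ) ≤ 2) h
  convert h2 using 1
  module

theorem add_mem (hK : IsSharpCone K f) {u v : V} (hu : u ∈ closure K) (hv : v ∈ K) :
    u + v ∈ K := by
  have hv' : v ∈ interior K := by rwa [hK.isOpen.interior_eq]
  have h := hK.convex.combo_closure_interior_mem_interior hu hv'
    (by norm_num : (0 : ℝ) ≤ 1 / 2) (by norm_num : (0 : ℝ) < 1 / 2) (by norm_num)
  rw [hK.isOpen.interior_eq] at h
  convert hK.smul_mem 2 (by norm_num) _ h using 1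
  module

theorem add_mem' (hK : IsSharpCone K f) {u v : V} (hu : u ∈ K) (hv : v ∈ closure K) :
    u + v ∈ K := by
  rw [add_comm]; exact hK.add_mem hv hu

theorem ne_zero (hK : IsSharpCone K f) {v : V} (hv : v ∈ K) : v ≠ 0 := by
  rintro rfl
  simpa using hK.pos 0 hv

theorem nonneg_closure_of_pos {φ : Module.Dual ℝ V} (hφ : ∀ v ∈ K, 0 < φ v) {v : V}
    (hv : v ∈ closure K) : 0 ≤ φ v :=
  closure_minimal (fun v hv => (hφ v hv).le)
    (isClosed_le continuous_const φ.continuous_of_finiteDimensional) hv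

theorem nonneg_closure (hK : IsSharpCone K f) {v : V} (hv : v ∈ closure K) : 0 ≤ f v :=
  nonneg_closure_of_pos hK.pos hv

/-- A point outside the cone is separated from it by a linear functional. -/
theorem exists_functional (hK : IsSharpCone K f) {u : V} (hu : u ∉ K) :
    ∃ φ : Module.Dual ℝ V, (∀ v ∈ K, 0 < φ v) ∧ φ u ≤ 0 := by
  obtain ⟨g, hg⟩ := geometric_hahn_banach_point_open hK.convex hK.isOpen hu
  have hcl : ∀ v ∈ closure K, g u ≤ g v := fun v hv =>
    closure_minimal (fun v hv => (hg v hv).le) (isClosed_le continuous_const g.continuous) hv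
  have hu0 : g u ≤ 0 := by simpa using hcl 0 hK.zero_mem_closure
  -- Scaling a point of negative value by `g u / g v + 1` would give the value `g u + g v`, which is
  -- less than `g u`.
  have hnn : ∀ v ∈ K, 0 ≤ g v := by
    intro v hv
    by_contra! hneg
    have h1 := hg _ (hK.smul_mem (g u / g v + 1) (by
      have := div_nonneg_of_nonpos hu0 hneg.le
      linarith) v hv)
    rw [map_smul, smul_eq_mul, add_mul, div_mul_cancel₀ _ hneg.ne] at h1
    linarith
  refine ⟨g.toLinearMap, fun v hv => ?_, hu0⟩
  by_contra! hle
  have hv0 : g v = 0 := le_antisymm hle (hnn v hv)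
  obtain ⟨w, hw⟩ := hK.nonempty
  -- moving from `v` away from a point where `g` is positive makes `g` negative
  have hev : ∀ᶠ t : ℝ in 𝓝[>] 0, v - t • w ∈ K := by
    have : Tendsto (fun t : ℝ => v - t • w) (𝓝[>] 0) (𝓝 v) := by
      have h : Tendsto (fun t : ℝ => v - t • w) (𝓝 0) (𝓝 (v - (0 : ℝ) • w)) :=
        (by fun_prop : Continuous fun t : ℝ => v - t • w).tendsto 0
      rw [zero_smul, sub_zero] at h
      exact h.mono_left nhdsWithin_le_nhds
    exact this (hK.isOpen.mem_nhds hv)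
  obtain ⟨t, ht, ht0⟩ := (hev.and self_mem_nhdsWithin).exists
  have ht0 : 0 < t := ht0
  have h1 := hnn _ ht
  have h2 := hnn _ hw
  rw [map_sub, map_smul, hv0, smul_eq_mul] at h1
  have h3 : g w = 0 := by nlinarith
  have h4 := hg _ hv
  have h5 := hg _ hw
  rw [hv0] at h4
  -- `g` attains its minimum `0` on `K` at the interior point `v`, hence vanishes identically,
  -- against `g u < 0`.
  have hz : ∀ x, g x = 0 := by
    intro x
    have hev : ∀ᶠ t : ℝ in 𝓝 0, v + t • x ∈ K := by
      have h : Tendsto (fun t : ℝ => v + t • x) (𝓝 0) (𝓝 (v + (0 : ℝ) • x)) :=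
        (by fun_prop : Continuous fun t : ℝ => v + t • x).tendsto 0
      rw [zero_smul, add_zero] at h
      exact h (hK.isOpen.mem_nhds hv)
    obtain ⟨ε, hε, hball⟩ := Metric.eventually_nhds_iff.1 hev
    have hp := hnn _ (hball (y := ε / 2) (by simp [abs_of_pos hε]; linarith))
    have hm := hnn _ (hball (y := -(ε / 2)) (by simp [abs_of_pos hε]; linarith))
    simp only [map_add, map_smul, hv0, smul_eq_mul, zero_add] at hp hm
    nlinarith
  rw [hz u] at h4
  exact lt_irrefl _ h4

/-- `f` is bounded below by a positive multiple of the norm on the closure of the cone. -/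
theorem exists_norm_le (hK : IsSharpCone K f) : ∃ c : ℝ, 0 < c ∧ ∀ v ∈ closure K, c * ‖v‖ ≤ f v := by
  have hcpt : IsCompact (closure K ∩ Metric.sphere 0 1) :=
    (isCompact_sphere 0 1).inter_left isClosed_closure
  have key : ∃ c : ℝ, 0 < c ∧ ∀ v ∈ closure K ∩ Metric.sphere 0 1, c ≤ f v := by
    rcases (closure K ∩ Metric.sphere 0 1).eq_empty_or_nonempty with h | h
    · exact ⟨1, one_pos, by simp [h]⟩
    · obtain ⟨w, hw, hmin⟩ := hcpt.exists_isMinOn h f.continuous_of_finiteDimensional.continuousOn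
      exact ⟨f w, hK.pos_closure w hw.1 (by
        rintro rfl
        simpa using hw.2), hmin⟩
  obtain ⟨c, hc, h⟩ := key
  refine ⟨c, hc, fun v hv => ?_⟩
  rcases eq_or_ne v 0 with rfl | hv0
  · simp
  have hn : 0 < ‖v‖ := norm_pos_iff.2 hv0
  have := h (‖v‖⁻¹ • v) ⟨hK.smul_mem_closure (by positivity) hv, by
    simp [norm_smul, hn.ne']⟩
  rw [map_smul, smul_eq_mul] at this
  calc c * ‖v‖ ≤ (‖v‖⁻¹ * f v) * ‖v‖ := by gcongr
    _ = f v := by field_simp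

end IsSharpCone

/-- Two linear functionals that agree on a nonempty open set are equal. -/
theorem dual_ext_of_isOpen {K : Set V} (hK : IsOpen K) (hne : K.Nonempty) {φ ψ : Module.Dual ℝ V}
    (h : ∀ v ∈ K, φ v = ψ v) : φ = ψ := by
  ext x
  obtain ⟨v, hv⟩ := hne
  have hev : ∀ᶠ t : ℝ in 𝓝[>] 0, v + t • x ∈ K := by
    have h : Tendsto (fun t : ℝ => v + t • x) (𝓝 0) (𝓝 (v + (0 : ℝ) • x)) :=
      (by fun_prop : Continuous fun t : ℝ => v + t • x).tendsto 0
    rw [zero_smul, add_zero] at h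
    exact (h.mono_left nhdsWithin_le_nhds) (hK.mem_nhds hv)
  obtain ⟨t, ht, ht0⟩ := (hev.and self_mem_nhdsWithin).exists
  have ht0 : 0 < t := ht0
  have h1 := h _ ht
  simp only [map_add, map_smul, h v hv, smul_eq_mul, add_right_inj] at h1
  exact mul_left_cancel₀ ht0.ne' h1

/-- Limits of triangles in thin cones are thin with respect to a set `L` that contains all limits
of points in the closures of the cones. -/
theorem IsThinCone.limit {K : ℕ → Set V} {L : Set V} {f : Module.Dual ℝ V} {R : ℝ}
    (hf : ∀ n, ∀ v ∈ closure (K n), 0 ≤ f v) (hthin : ∀ n, IsThinCone R (K n))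
    (hL : ∀ (φ : ℕ → ℕ) (v : ℕ → V) (w : V), StrictMono φ → (∀ k, v k ∈ closure (K (φ k))) →
      Tendsto v atTop (𝓝 w) → w ∈ L)
    {xs ys zs ps : ℕ → V} {x y z p : V} (hxs : ∀ n, xs n ∈ K n) (hys : ∀ n, ys n ∈ K n)
    (hzs : ∀ n, zs n ∈ K n) (hps : ∀ n, ps n ∈ segment ℝ (xs n) (ys n))
    (hx : Tendsto xs atTop (𝓝 x)) (hy : Tendsto ys atTop (𝓝 y)) (hz : Tendsto zs atTop (𝓝 z))
    (hp : Tendsto ps atTop (𝓝 p)) (hfx : 0 < f x) (hfy : 0 < f y) (hfz : 0 < f z) :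
    ∃ q ∈ segment ℝ y z ∪ segment ℝ z x, ∃ a b : ℝ, 0 ≤ a ∧ 0 ≤ b ∧ a * b ≤ R ∧ a • q - p ∈ L ∧
      b • p - q ∈ L := by
  have hfc : Continuous f := f.continuous_of_finiteDimensional
  -- The union of two sides is described by barycentric weights, those of `y`, `z`, `x` in this
  -- order, in which the weights of `y` and `x` have product zero. This is a closed condition on a
  -- compact set.
  have key : ∀ n, ∃ c : (ℝ × ℝ × ℝ) × ℝ × ℝ,
      (0 ≤ c.1.1 ∧ 0 ≤ c.1.2.1 ∧ 0 ≤ c.1.2.2 ∧ c.1.1 + c.1.2.1 + c.1.2.2 = 1 ∧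
        c.1.1 * c.1.2.2 = 0) ∧ c.2.1 * c.2.2 ≤ R ∧
      c.2.1 • (c.1.1 • ys n + c.1.2.1 • zs n + c.1.2.2 • xs n) - ps n ∈ closure (K n) ∧
      c.2.2 • ps n - (c.1.1 • ys n + c.1.2.1 • zs n + c.1.2.2 • xs n) ∈ closure (K n) := by
    intro n
    obtain ⟨q, hq, a, b, hab, h1, h2⟩ := hthin n _ (hxs n) _ (hys n) _ (hzs n) _ (hps n)
    rcases hq with ⟨s, t, hs, ht, hst, rfl⟩ | ⟨s, t, hs, ht, hst, rfl⟩
    · exact ⟨((s, t, 0), a, b), ⟨hs, ht, le_rfl, by simpa using hst, by simp⟩, hab,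
        by simpa using h1, by simpa using h2⟩
    · exact ⟨((0, s, t), a, b), ⟨le_rfl, hs, ht, by simpa using hst, by simp⟩, hab,
        by simpa using h1, by simpa using h2⟩
  choose c hc hcR hc1 hc2 using key
  obtain ⟨m, hm, hmx, hmy, hmz⟩ : ∃ m : ℝ, 0 < m ∧ m < f x ∧ m < f y ∧ m < f z := by
    refine ⟨min (f x) (min (f y) (f z)) / 2, by positivity, ?_, ?_, ?_⟩ <;>
    · have h1 := min_le_left (f x) (min (f y) (f z))
      have h2 := min_le_right (f x) (min (f y) (f z))
      have h3 := min_le_left (f y) (f z)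
      have h4 := min_le_right (f y) (f z)
      have h5 : 0 < min (f x) (min (f y) (f z)) := by positivity
      linarith
  obtain ⟨N, hNx, hNy, hNz⟩ : ∃ N : ℝ, f x < N ∧ f y < N ∧ f z < N :=
    ⟨f x + f y + f z, by linarith, by linarith, by linarith⟩
  have hNpos : 0 < N := hfx.trans hNx
  have hR : ∀ᶠ n in atTop, c n ∈ (Set.Icc (0 : ℝ) 1 ×ˢ Set.Icc (0 : ℝ) 1 ×ˢ Set.Icc (0 : ℝ) 1) ×ˢ
      Set.Icc 0 (R / (m / N)) ×ˢ Set.Icc 0 (R / (m / N)) := by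
    have ev : ∀ {us : ℕ → V} {u : V}, Tendsto us atTop (𝓝 u) → m < f u → f u < N →
        ∀ᶠ n in atTop, f (us n) ∈ Set.Icc m N := fun hu h1 h2 =>
      ((hfc.tendsto _).comp hu) (Icc_mem_nhds h1 h2)
    filter_upwards [ev hx hmx hNx, ev hy hmy hNy, ev hz hmz hNz] with n h1 h2 h3
    obtain ⟨i1, i2, i3, i4, i5⟩ := hc n
    have hcv : Convex ℝ (f ⁻¹' Set.Icc m N) := (convex_Icc m N).is_linear_preimage f.isLinear
    have hfp : f (ps n) ∈ Set.Icc m N := hcv.segment_subset h1 h2 (hps n)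
    have hfq : f ((c n).1.1 • ys n + (c n).1.2.1 • zs n + (c n).1.2.2 • xs n) ∈ Set.Icc m N := by
      simp only [map_add, map_smul, smul_eq_mul, Set.mem_Icc] at h1 h2 h3 ⊢
      constructor <;> nlinarith
    set q := (c n).1.1 • ys n + (c n).1.2.1 • zs n + (c n).1.2.2 • xs n
    have j1 := hf n _ (hc1 n)
    have j2 := hf n _ (hc2 n)
    rw [map_sub, map_smul, smul_eq_mul, sub_nonneg] at j1 j2
    -- Applying `f` to the two comparisons bounds both factors below by `m / N`; then `a * b ≤ R`
    -- bounds each of them above.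
    have lower : ∀ {a s t : ℝ}, s ∈ Set.Icc m N → t ∈ Set.Icc m N → t ≤ a * s → m / N ≤ a := by
      intro a s t hs ht h
      have : 0 < a := by
        by_contra! ha
        nlinarith [hs.1, ht.1]
      rw [div_le_iff₀ hNpos]
      nlinarith [hs.2, ht.1]
    have k1 := lower hfq hfp j1
    have k2 := lower hfp hfq j2
    have hmN : 0 < m / N := by positivity
    have l1 : (c n).2.1 ≤ R / (m / N) := by
      rw [le_div_iff₀ hmN]; nlinarith [hcR n]
    have l2 : (c n).2.2 ≤ R / (m / N) := by
      rw [le_div_iff₀ hmN]; nlinarith [hcR n]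
    exact ⟨⟨⟨i1, by linarith⟩, ⟨i2, by linarith⟩, ⟨i3, by linarith⟩⟩,
      ⟨by linarith, l1⟩, ⟨by linarith, l2⟩⟩
  have hcpt : IsCompact ((Set.Icc (0 : ℝ) 1 ×ˢ Set.Icc (0 : ℝ) 1 ×ˢ Set.Icc (0 : ℝ) 1) ×ˢ
      Set.Icc 0 (R / (m / N)) ×ˢ Set.Icc 0 (R / (m / N))) :=
    (isCompact_Icc.prod (isCompact_Icc.prod isCompact_Icc)).prod
      (isCompact_Icc.prod isCompact_Icc)
  obtain ⟨⟨⟨s, t, r⟩, a, b⟩, hlim, φ, hφ, hcφ⟩ := hcpt.tendsto_subseq' hR.frequently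
  have e1 : Tendsto (fun k => (c (φ k)).1.1) atTop (𝓝 s) :=
    ((by fun_prop : Continuous fun e : (ℝ × ℝ × ℝ) × ℝ × ℝ => e.1.1).tendsto _).comp hcφ
  have e2 : Tendsto (fun k => (c (φ k)).1.2.1) atTop (𝓝 t) :=
    ((by fun_prop : Continuous fun e : (ℝ × ℝ × ℝ) × ℝ × ℝ => e.1.2.1).tendsto _).comp hcφ
  have e3 : Tendsto (fun k => (c (φ k)).1.2.2) atTop (𝓝 r) :=
    ((by fun_prop : Continuous fun e : (ℝ × ℝ × ℝ) × ℝ × ℝ => e.1.2.2).tendsto _).comp hcφ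
  have e4 : Tendsto (fun k => (c (φ k)).2.1) atTop (𝓝 a) :=
    ((by fun_prop : Continuous fun e : (ℝ × ℝ × ℝ) × ℝ × ℝ => e.2.1).tendsto _).comp hcφ
  have e5 : Tendsto (fun k => (c (φ k)).2.2) atTop (𝓝 b) :=
    ((by fun_prop : Continuous fun e : (ℝ × ℝ × ℝ) × ℝ × ℝ => e.2.2).tendsto _).comp hcφ
  have hx' := hx.comp hφ.tendsto_atTop
  have hy' := hy.comp hφ.tendsto_atTop
  have hz' := hz.comp hφ.tendsto_atTop
  have hp' := hp.comp hφ.tendsto_atTop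
  have hq' := ((e1.smul hy').add (e2.smul hz')).add (e3.smul hx')
  have hs0 : 0 ≤ s := ge_of_tendsto' e1 fun k => (hc _).1
  have ht0 : 0 ≤ t := ge_of_tendsto' e2 fun k => (hc _).2.1
  have hr0 : 0 ≤ r := ge_of_tendsto' e3 fun k => (hc _).2.2.1
  have hsum : s + t + r = 1 := tendsto_nhds_unique ((e1.add e2).add e3)
    (by simp only [(hc _).2.2.2.1]; exact tendsto_const_nhds)
  have hprod : s * r = 0 := tendsto_nhds_unique (e1.mul e3)
    (by simp only [(hc _).2.2.2.2]; exact tendsto_const_nhds)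
  refine ⟨s • y + t • z + r • x, ?_, a, b, hlim.2.1.1, hlim.2.2.1,
    le_of_tendsto' (e4.mul e5) fun k => hcR _,
    hL φ _ _ hφ (fun k => hc1 (φ k)) ((e4.smul hq').sub hp'),
    hL φ _ _ hφ (fun k => hc2 (φ k)) ((e5.smul hp').sub hq')⟩
  rcases mul_eq_zero.1 hprod with rfl | rfl
  · exact Or.inr ⟨t, r, ht0, hr0, by linarith, by simp⟩
  · exact Or.inl ⟨s, t, hs0, ht0, by linarith, by simp⟩

end Cones

/-! ### Strict convexity and smoothness of thin cones -/

section Cones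

variable {V : Type*} [NormedAddCommGroup V] [NormedSpace ℝ V] [FiniteDimensional ℝ V]

/-- The boundary of a thin sharp cone contains no two-dimensional face. -/
theorem IsSharpCone.eq_of_isThinCone {K : Set V} {f : Module.Dual ℝ V} {R : ℝ}
    (hK : IsSharpCone K f) (hthin : IsThinCone R K) {φ : Module.Dual ℝ V}
    (hφ : ∀ v ∈ K, 0 < φ v) {u v : V} (hu : u ∈ closure K) (hv : v ∈ closure K) (hfu : f u = 1)
    (hfv : f v = 1) (hφu : φ u = 0) (hφv : φ v = 0) : u = v := by
  by_contra hne
  have hvu : 0 < ‖v - u‖ := norm_pos_iff.2 (sub_ne_zero.2 (Ne.symm hne))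
  obtain ⟨c, hc, hcn⟩ := hK.exists_norm_le
  -- The segment is prolonged to a maximal one in the closed cone, with ends `a`, `b` and midpoint
  -- `m`. It is bounded because `f` is constant on it and controls the norm.
  set T : Set ℝ := {t | u + t • (v - u) ∈ closure K} with hT
  have hft : ∀ t : ℝ, f (u + t • (v - u)) = 1 := by
    intro t; simp [hfu, hfv]
  have hφt : ∀ t : ℝ, φ (u + t • (v - u)) = 0 := by
    intro t; simp [hφu, hφv]
  have hTb : ∀ t ∈ T, |t| ≤ (1 / c + ‖u‖) / ‖v - u‖ := by
    intro t ht
    have h1 := hcn _ ht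
    rw [hft, mul_comm, ← le_div_iff₀ hc] at h1
    rw [le_div_iff₀ hvu]
    calc |t| * ‖v - u‖ = ‖(u + t • (v - u)) - u‖ := by
          rw [add_sub_cancel_left, norm_smul, Real.norm_eq_abs]
      _ ≤ ‖u + t • (v - u)‖ + ‖u‖ := norm_sub_le _ _
      _ ≤ _ := by gcongr
  have hTc : IsClosed T := isClosed_closure.preimage (by fun_prop)
  have hT0 : (0 : ℝ) ∈ T := by simpa [hT] using hu
  have hT1 : (1 : ℝ) ∈ T := by simpa [hT] using hv
  have hTbb : BddBelow T := ⟨_, fun t ht => (abs_le.1 (hTb t ht)).1⟩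
  have hTba : BddAbove T := ⟨_, fun t ht => (abs_le.1 (hTb t ht)).2⟩
  set s := sInf T
  set t := sSup T
  have hs : s ∈ T := hTc.csInf_mem ⟨0, hT0⟩ hTbb
  have ht : t ∈ T := hTc.csSup_mem ⟨0, hT0⟩ hTba
  have hst : s < t := (csInf_le hTbb hT0).trans_lt (one_pos.trans_le (le_csSup hTba hT1))
  set a := u + s • (v - u) with ha
  set b := u + t • (v - u) with hb
  set m := u + ((s + t) / 2) • (v - u) with hm
  obtain ⟨z, hz⟩ := hK.nonempty
  set e : ℕ → ℝ := fun n => 1 / ((n : ℝ) + 1)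
  have he : Tendsto e atTop (𝓝 0) := tendsto_one_div_add_atTop_nhds_zero_nat
  have he0 : ∀ n, 0 < e n := fun n => Nat.one_div_pos_of_nat
  have hlim : ∀ w : V, Tendsto (fun n => w + e n • z) atTop (𝓝 w) := by
    intro w
    simpa using tendsto_const_nhds (x := w) |>.add (he.smul_const z)
  have hmem : ∀ w ∈ closure K, ∀ n, w + e n • z ∈ K := fun w hw n =>
    hK.add_mem hw (hK.smul_mem _ (he0 n) _ hz)
  -- The side from `a` to `b` lies in the boundary, so thinness is applied to the triangles shifted
  -- into `K` by `e n • z`. In the limit `m` is comparable to a point `q` of the sides through `z`.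
  obtain ⟨q, hq, α, β, hα, hβ, -, h1, h2⟩ := IsThinCone.limit (K := fun _ => K) (L := closure K)
    (f := f) (fun _ v hv => hK.nonneg_closure hv) (fun _ => hthin)
    (fun φ v w _ hv hw => isClosed_closure.mem_of_tendsto hw (.of_forall hv))
    (xs := fun n => a + e n • z) (ys := fun n => b + e n • z) (zs := fun _ => z)
    (ps := fun n => m + e n • z) (hmem a hs) (hmem b ht) (fun _ => hz)
    (fun n => ⟨1 / 2, 1 / 2, by norm_num, by norm_num, by norm_num, by
      simp only [ha, hb, hm]; module⟩)
    (hlim a) (hlim b) tendsto_const_nhds (hlim m) (by rw [hft]; exact one_pos)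
    (by rw [hft]; exact one_pos) (hK.pos z hz)
  -- Comparability with `m`, a zero of `φ`, keeps `q` out of `K`; since any positive share of `z`
  -- leads into `K`, only the ends `a` and `b` remain.
  have hqK : q ∉ K := by
    intro hqK
    have hβm : β • m ∈ K := by simpa using hK.add_mem h2 hqK
    have := hφ _ hβm
    rw [map_smul, hφt, smul_zero] at this
    exact lt_irrefl _ this
  have hend : ∀ w ∈ closure K, ∀ r r' : ℝ, 0 ≤ r → 0 ≤ r' → r + r' = 1 → q = r • w + r' • z →
      q = w := by
    intro w hw r r' hr hr' hrr hq
    rcases hr'.eq_or_lt with rfl | hr'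
    · rw [add_zero] at hrr
      simpa [hrr] using hq
    · exact absurd (hq ▸ hK.add_mem (hK.smul_mem_closure hr hw) (hK.smul_mem _ hr' _ hz)) hqK
  have hαf := hK.nonneg_closure h1
  rcases hq with ⟨r, r', hr, hr', hrr, hq⟩ | ⟨r, r', hr, hr', hrr, hq⟩
  · have hqb := hend b ht r r' hr hr' hrr hq.symm
    rw [hqb, map_sub, map_smul, hft, hft, smul_eq_mul, mul_one, sub_nonneg] at hαf
    rcases hαf.eq_or_lt with hα1 | hα1
    · have h0 := (mt (hK.pos_closure _ h1)) (by
        rw [hqb, ← hα1, one_smul, map_sub, hft, hft, sub_self]; exact lt_irrefl _)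
      rw [not_not, hqb, ← hα1, one_smul, hb, hm] at h0
      have : ((t - s) / 2) • (v - u) = 0 := by
        rw [← h0]; module
      rcases smul_eq_zero.1 this with h | h
      · linarith
      · exact hne (sub_eq_zero.1 h).symm
    -- `α • b - m`, normalized, lies on the same line strictly beyond `b`, against the maximality of
    -- `t`.
    · have hmemT : (α * t - (s + t) / 2) / (α - 1) ∈ T := by
        have h3 := hK.smul_mem_closure (inv_nonneg.2 (sub_pos.2 hα1).le) h1
        rw [hT, Set.mem_ofPred_eq]
        convert h3 using 1
        rw [hqb, hb, hm]
        have h4 : α - 1 ≠ 0 := (sub_pos.2 hα1).ne'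
        match_scalars <;> field_simp <;> ring
      have := le_csSup hTba hmemT
      rw [div_le_iff₀ (sub_pos.2 hα1)] at this
      nlinarith
  · have hqa := hend a hs r' r hr' hr (by linarith) (by rw [← hq, add_comm])
    rw [hqa, map_sub, map_smul, hft, hft, smul_eq_mul, mul_one, sub_nonneg] at hαf
    rcases hαf.eq_or_lt with hα1 | hα1
    · have h0 := (mt (hK.pos_closure _ h1)) (by
        rw [hqa, ← hα1, one_smul, map_sub, hft, hft, sub_self]; exact lt_irrefl _)
      rw [not_not, hqa, ← hα1, one_smul, ha, hm] at h0
      have : ((s - t) / 2) • (v - u) = 0 := by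
        rw [← h0]; module
      rcases smul_eq_zero.1 this with h | h
      · linarith
      · exact hne (sub_eq_zero.1 h).symm
    · have hmemT : (α * s - (s + t) / 2) / (α - 1) ∈ T := by
        have h3 := hK.smul_mem_closure (inv_nonneg.2 (sub_pos.2 hα1).le) h1
        rw [hT, Set.mem_ofPred_eq]
        convert h3 using 1
        rw [hqa, ha, hm]
        have h4 : α - 1 ≠ 0 := (sub_pos.2 hα1).ne'
        match_scalars <;> field_simp <;> ring
      have := csInf_le hTbb hmemT
      rw [le_div_iff₀ (sub_pos.2 hα1)] at this
      nlinarith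

/-- A limit of thin cones is thin. -/
theorem IsThinCone.of_limit {K : ℕ → Set V} {L : Set V} {f : Module.Dual ℝ V} {R : ℝ}
    (hf : ∀ n, ∀ v ∈ closure (K n), 0 ≤ f v) (hthin : ∀ n, IsThinCone R (K n))
    (hfL : ∀ v ∈ L, 0 < f v) (hev : ∀ v ∈ L, ∀ᶠ n in atTop, v ∈ K n)
    (hL : ∀ (φ : ℕ → ℕ) (v : ℕ → V) (w : V), StrictMono φ → (∀ k, v k ∈ closure (K (φ k))) →
      Tendsto v atTop (𝓝 w) → w ∈ closure L) : IsThinCone R L := by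
  intro x hx y hy z hz p hp
  obtain ⟨N, hN⟩ := eventually_atTop.1 ((hev x hx).and ((hev y hy).and (hev z hz)))
  obtain ⟨q, hq, a, b, -, -, hab, h1, h2⟩ := IsThinCone.limit (K := fun n => K (n + N))
    (L := closure L) (fun n => hf _) (fun n => hthin _)
    (fun φ v w hφ hv hw => hL (fun k => φ k + N) v w (fun i j hij => by
      have := hφ hij
      simp only
      omega) hv hw)
    (xs := fun _ => x) (ys := fun _ => y) (zs := fun _ => z) (ps := fun _ => p)
    (fun n => (hN _ (Nat.le_add_left _ _)).1) (fun n => (hN _ (Nat.le_add_left _ _)).2.1)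
    (fun n => (hN _ (Nat.le_add_left _ _)).2.2) (fun _ => hp) tendsto_const_nhds
    tendsto_const_nhds tendsto_const_nhds tendsto_const_nhds (hfL x hx) (hfL y hy) (hfL z hz)
  exact ⟨q, hq, a, b, hab, h1, h2⟩

/-- Thinness is invariant under linear isomorphisms. -/
theorem IsThinCone.preimage {K : Set V} {R : ℝ} (hK : IsThinCone R K) (T : V ≃ₗ[ℝ] V) :
    IsThinCone R (T ⁻¹' K) := by
  have hT : closure (T ⁻¹' K) = T ⁻¹' closure K :=
    (T.toContinuousLinearEquiv.toHomeomorph.preimage_closure K).symm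
  have himg : ∀ x y q, q ∈ segment ℝ (T x) (T y) → T.symm q ∈ segment ℝ x y := by
    rintro x y q ⟨a, b, ha, hb, hab, rfl⟩
    exact ⟨a, b, ha, hb, hab, by simp⟩
  intro x hx y hy z hz p hp
  obtain ⟨q, hq, a, b, hab, h1, h2⟩ := hK _ hx _ hy _ hz (T p) (by
    obtain ⟨a, b, ha, hb, hab, rfl⟩ := hp
    exact ⟨a, b, ha, hb, hab, by simp⟩)
  refine ⟨T.symm q, ?_, a, b, hab, ?_, ?_⟩
  · exact hq.imp (himg _ _ _) (himg _ _ _)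
  · rw [hT, Set.mem_preimage]; simpa using h1
  · rw [hT, Set.mem_preimage]; simpa using h2

/-- The homothety of ratio `s ≠ 0` with centre `p` of the affine plane `{f = 1}`, extended to a
linear automorphism. -/
noncomputable def homothety (f : Module.Dual ℝ V) (p : V) (hp : f p = 1) (s : ℝ) (hs : s ≠ 0) :
    V ≃ₗ[ℝ] V :=
  LinearEquiv.ofLinearMap ((1 - s) • f.smulRight p + s • LinearMap.id)
    ((1 - s⁻¹) • f.smulRight p + s⁻¹ • LinearMap.id)
    (by
      ext v
      simp [hp]
      match_scalars <;> field_simp <;> ring)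
    (by
      ext v
      simp [hp]
      match_scalars <;> field_simp <;> ring)

theorem homothety_apply (f : Module.Dual ℝ V) (p : V) (hp : f p = 1) (s : ℝ) (hs : s ≠ 0) (v : V) :
    homothety f p hp s hs v = (1 - s) • f v • p + s • v := by
  simp [homothety]

/-- In dimension three, the boundary of a thin sharp cone has only one supporting plane at each of
its points. -/
theorem IsSharpCone.exists_eq_smul {K : Set V} {f : Module.Dual ℝ V} {R : ℝ}
    (hdim : Module.finrank ℝ V = 3) (hK : IsSharpCone K f) (hthin : IsThinCone R K) {p : V}
    (hp : p ∈ closure K) (hp0 : p ≠ 0) {φ ψ : Module.Dual ℝ V} (hφ : ∀ v ∈ K, 0 < φ v)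
    (hψ : ∀ v ∈ K, 0 < ψ v) (hφp : φ p = 0) (hψp : ψ p = 0) : ∃ c : ℝ, ψ = c • φ := by
  wlog hfp : f p = 1 generalizing p
  · have h0 := hK.pos_closure p hp hp0
    exact this (p := (f p)⁻¹ • p) (hK.smul_mem_closure (by positivity) hp)
      (smul_ne_zero (by positivity) hp0) (by simp [hφp]) (by simp [hψp]) (by simp [h0.ne'])
  by_contra hc
  obtain ⟨k₀, hk₀⟩ := hK.nonempty
  -- otherwise `φ`, `ψ` and `f` have no common zero
  have hzero : ∀ v, φ v = 0 → ψ v = 0 → f v = 0 → v = 0 := by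
    intro v h1 h2 h3
    by_contra hv
    -- The common zeros `p` and `v` of `φ` and `ψ` form a basis together with `k₀`, and on this
    -- basis the functionals are proportional. This is where dimension three enters.
    refine hc ⟨ψ k₀ / φ k₀, ?_⟩
    have hk := hφ k₀ hk₀
    have hli : LinearIndependent ℝ ![p, v, k₀] := by
      rw [Fintype.linearIndependent_iff]
      intro g hg
      simp only [Fin.sum_univ_three, Matrix.cons_val] at hg
      have g2 : g 2 = 0 := by simpa [hφp, h1, hk.ne'] using congrArg φ hg
      have g0 : g 0 = 0 := by simpa [hfp, h3, g2] using congrArg f hg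
      have g1 : g 1 = 0 := by simpa [g0, g2, hv] using hg
      intro i
      fin_cases i <;> assumption
    let b := basisOfLinearIndependentOfCardEqFinrank hli (by simp [hdim])
    refine b.ext fun i => ?_
    fin_cases i
    · simp [b, hφp, hψp]
    · simp [b, h1, h2]
    · simp [b, hk.ne']
  set T : ∀ s : ℝ, s ≠ 0 → V ≃ₗ[ℝ] V := homothety f p hfp
  have hTf : ∀ s hs v, f (T s hs v) = f v := by
    intro s hs v; simp [T, homothety_apply, hfp]; ring
  have hTφ : ∀ s hs v, φ (T s hs v) = s * φ v := by
    intro s hs v; simp [T, homothety_apply, hφp]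
  have hTψ : ∀ s hs v, ψ (T s hs v) = s * ψ v := by
    intro s hs v; simp [T, homothety_apply, hψp]
  -- Zooming in at `p`: the preimages of `K` under the homotheties grow as `s` decreases to `0`, and
  -- their union is the tangent cone at `p`. On it `f`, `φ` and `ψ` stay positive, so by `hzero`
  -- their sum makes it sharp.
  set L : Set V := {v | ∃ s : ℝ, ∃ hs : s ≠ 0, 0 < s ∧ T s hs v ∈ K} with hLdef
  have hmono : ∀ s hs v, 0 < s → T s hs v ∈ K → ∀ s' hs', 0 < s' → s' ≤ s → T s' hs' v ∈ K := by
    intro s hs v hs0 hv s' hs' hs'0 hle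
    have hfv : 0 < f v := by simpa [hTf] using hK.pos _ hv
    have h1 := hK.smul_mem (s' / s) (by positivity) _ hv
    have h2 : ((1 - s' / s) * f v) • p ∈ closure K := hK.smul_mem_closure (mul_nonneg (by
      rw [sub_nonneg, div_le_one hs0]; exact hle) hfv.le) hp
    convert hK.add_mem h2 h1 using 1
    simp only [T, homothety_apply]
    match_scalars <;> field_simp
    ring
  have hLf : ∀ v ∈ L, 0 < f v := by
    rintro v ⟨s, hs, -, hv⟩
    simpa [hTf] using hK.pos _ hv
  have hLφ : ∀ v ∈ L, 0 < φ v := by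
    rintro v ⟨s, hs, hs0, hv⟩
    have := hφ _ hv
    rw [hTφ] at this
    exact pos_of_mul_pos_right this hs0.le
  have hLψ : ∀ v ∈ L, 0 < ψ v := by
    rintro v ⟨s, hs, hs0, hv⟩
    have := hψ _ hv
    rw [hTψ] at this
    exact pos_of_mul_pos_right this hs0.le
  have hsharp : IsSharpCone L (f + φ + ψ) := by
    refine ⟨?_, ?_, ⟨k₀, 1, one_ne_zero, one_pos, by simpa [T, homothety_apply] using hk₀⟩, ?_, ?_,
      ?_⟩
    · have : L = ⋃ (s : ℝ) (hs : s ≠ 0) (_ : 0 < s), T s hs ⁻¹' K := by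
        ext v; simp [hLdef]
      rw [this]
      exact isOpen_iUnion fun s => isOpen_iUnion fun hs => isOpen_iUnion fun _ =>
        hK.isOpen.preimage (T s hs).toLinearMap.continuous_of_finiteDimensional
    · rintro x ⟨s, hs, hs0, hx⟩ y ⟨t, ht, ht0, hy⟩ a b ha hb hab
      have hm0 : 0 < min s t := lt_min hs0 ht0
      refine ⟨min s t, hm0.ne', hm0, ?_⟩
      rw [map_add, map_smul, map_smul]
      exact hK.convex (hmono _ _ _ hs0 hx _ _ hm0 (min_le_left _ _))
        (hmono _ _ _ ht0 hy _ _ hm0 (min_le_right _ _)) ha hb hab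
    · rintro c hc v ⟨s, hs, hs0, hv⟩
      exact ⟨s, hs, hs0, by rw [map_smul]; exact hK.smul_mem c hc _ hv⟩
    · intro v hv
      simp only [LinearMap.add_apply]
      linarith [hLf v hv, hLφ v hv, hLψ v hv]
    · intro v hv hv0
      have h1 := IsSharpCone.nonneg_closure_of_pos hLf hv
      have h2 := IsSharpCone.nonneg_closure_of_pos hLφ hv
      have h3 := IsSharpCone.nonneg_closure_of_pos hLψ hv
      simp only [LinearMap.add_apply]
      by_contra! h
      exact hv0 (hzero v (by linarith) (by linarith) (by linarith))
  set e : ℕ → ℝ := fun n => 1 / ((n : ℝ) + 1)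
  have he0 : ∀ n, 0 < e n := fun n => Nat.one_div_pos_of_nat
  have he : Tendsto e atTop (𝓝 0) := tendsto_one_div_add_atTop_nhds_zero_nat
  have hsub : ∀ n, closure (T (e n) (he0 n).ne' ⁻¹' K) ⊆ closure L := fun n =>
    closure_mono fun v hv => ⟨e n, (he0 n).ne', he0 n, hv⟩
  have hLthin : IsThinCone R L := IsThinCone.of_limit (K := fun n => T (e n) (he0 n).ne' ⁻¹' K)
    (f := f + φ + ψ) (fun n v hv => hsharp.nonneg_closure (hsub n hv))
    (fun n => hthin.preimage _) hsharp.pos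
    (by
      rintro v ⟨s, hs, hs0, hv⟩
      filter_upwards [he.eventually (gt_mem_nhds hs0)] with n hn
      exact hmono s hs v hs0 hv _ _ (he0 n) hn.le)
    (fun g v w _ hv hw => isClosed_closure.mem_of_tendsto hw (.of_forall fun k => hsub _ (hv k)))
  -- These directions lie in the plane `{f = 0}`, which supports `L`. As `L` is thin, hence strictly
  -- convex, they all span one ray, so the ratio of `ψ` to `φ` is constant on `K`.
  have hdir : ∀ k ∈ K, k - f k • p ∈ closure L := by
    intro k hk
    have hlim : Tendsto (fun n => (e n * f k) • p + (k - f k • p)) atTop (𝓝 (k - f k • p)) := by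
      simpa using ((he.mul_const (f k)).smul_const p).add_const (k - f k • p)
    refine isClosed_closure.mem_of_tendsto hlim (.of_forall fun n => subset_closure ?_)
    refine ⟨e n, (he0 n).ne', he0 n, ?_⟩
    convert hK.smul_mem _ (he0 n) k hk using 1
    simp only [T, homothety_apply, map_add, map_sub, map_smul, hfp]
    module
  have hpos : ∀ k ∈ K, 0 < φ k + ψ k := fun k hk => add_pos (hφ k hk) (hψ k hk)
  refine hc ⟨ψ k₀ / φ k₀, dual_ext_of_isOpen hK.isOpen hK.nonempty fun k hk => ?_⟩
  have hval : ∀ k, (f + φ + ψ) (k - f k • p) = φ k + ψ k := by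
    intro k; simp [hfp, hφp, hψp]
  have heq := hsharp.eq_of_isThinCone hLthin hLf
    (hsharp.smul_mem_closure (inv_nonneg.2 (hpos k hk).le) (hdir k hk))
    (hsharp.smul_mem_closure (inv_nonneg.2 (hpos k₀ hk₀).le) (hdir k₀ hk₀))
    (by rw [map_smul, hval, smul_eq_mul, inv_mul_cancel₀ (hpos k hk).ne'])
    (by rw [map_smul, hval, smul_eq_mul, inv_mul_cancel₀ (hpos k₀ hk₀).ne'])
    (by simp [hfp]) (by simp [hfp])
  have h1 := congrArg φ heq
  have := hpos k hk
  have := hpos k₀ hk₀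
  have := hφ k₀ hk₀
  simp only [map_smul, map_sub, hφp, smul_eq_mul, mul_zero, sub_zero] at h1
  rw [LinearMap.smul_apply, smul_eq_mul]
  field_simp at h1 ⊢
  linarith

end Cones

/-! ### The Hilbert metric in terms of the order of a cone -/

section HilbertCones

variable {V : Type*} [NormedAddCommGroup V] [NormedSpace ℝ V] [FiniteDimensional ℝ V]

/-- The least `c` such that `x ≤ c • y` in the order defined by the closed cone `closure K`. -/
noncomputable def coneRatio (K : Set V) (x y : V) : ℝ :=
  sInf {c : ℝ | c • y - x ∈ closure K}

theorem coneRatio_eq {K : Set V} {x y : V} {c : ℝ} (hc : c • y - x ∈ closure K)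
    (h : ∀ d : ℝ, d • y - x ∈ closure K → c ≤ d) : coneRatio K x y = c :=
  IsLeast.csInf_eq ⟨hc, h⟩

namespace IsSharpCone

variable {K : Set V} {f : Module.Dual ℝ V}

theorem isLeast_coneRatio (hK : IsSharpCone K f) {x y : V} (_ : x ∈ K) (hy : y ∈ K) :
    IsLeast {c : ℝ | c • y - x ∈ closure K} (coneRatio K x y) := by
  have hbb : BddBelow {c : ℝ | c • y - x ∈ closure K} := by
    refine ⟨f x / f y, fun c hc => ?_⟩
    have := hK.nonneg_closure hc
    rw [map_sub, map_smul, smul_eq_mul] at this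
    rw [div_le_iff₀ (hK.pos y hy)]
    linarith
  have hne : {c : ℝ | c • y - x ∈ closure K}.Nonempty := by
    have hev : ∀ᶠ t : ℝ in 𝓝[>] 0, y - t • x ∈ K := by
      have h : Tendsto (fun t : ℝ => y - t • x) (𝓝 0) (𝓝 (y - (0 : ℝ) • x)) :=
        (by fun_prop : Continuous fun t : ℝ => y - t • x).tendsto 0
      rw [zero_smul, sub_zero] at h
      exact (h.mono_left nhdsWithin_le_nhds) (hK.isOpen.mem_nhds hy)
    obtain ⟨t, ht, ht0⟩ := (hev.and self_mem_nhdsWithin).exists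
    have ht0 : 0 < t := ht0
    refine ⟨t⁻¹, subset_closure ?_⟩
    convert hK.smul_mem t⁻¹ (by positivity) _ ht using 1
    rw [smul_sub, inv_smul_smul₀ ht0.ne']
  have hcl : IsClosed {c : ℝ | c • y - x ∈ closure K} :=
    isClosed_closure.preimage (by fun_prop : Continuous fun c : ℝ => c • y - x)
  exact ⟨hcl.csInf_mem hne hbb, fun c hc => csInf_le hbb hc⟩

theorem coneRatio_mem (hK : IsSharpCone K f) {x y : V} (hx : x ∈ K) (hy : y ∈ K) :
    coneRatio K x y • y - x ∈ closure K := (hK.isLeast_coneRatio hx hy).1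

theorem coneRatio_le (hK : IsSharpCone K f) {x y : V} (hx : x ∈ K) (hy : y ∈ K) {c : ℝ}
    (hc : c • y - x ∈ closure K) : coneRatio K x y ≤ c := (hK.isLeast_coneRatio hx hy).2 hc

theorem coneRatio_pos (hK : IsSharpCone K f) {x y : V} (hx : x ∈ K) (hy : y ∈ K) :
    0 < coneRatio K x y := by
  have h := hK.nonneg_closure (hK.coneRatio_mem hx hy)
  rw [map_sub, map_smul, smul_eq_mul] at h
  have := hK.pos x hx
  exact pos_of_mul_pos_left (by linarith) (hK.pos y hy).le

theorem coneRatio_notMem (hK : IsSharpCone K f) {x y : V} (hx : x ∈ K) (hy : y ∈ K) :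
    coneRatio K x y • y - x ∉ K := by
  intro hmem
  have hev : ∀ᶠ t : ℝ in 𝓝[<] coneRatio K x y, t • y - x ∈ K :=
    ((by fun_prop : Continuous fun t : ℝ => t • y - x).tendsto _).mono_left nhdsWithin_le_nhds
      (hK.isOpen.mem_nhds hmem)
  obtain ⟨t, ht, ht0⟩ := (hev.and self_mem_nhdsWithin).exists
  exact absurd (hK.coneRatio_le hx hy (subset_closure ht)) (not_le.2 ht0)

theorem mem_of_coneRatio_lt (hK : IsSharpCone K f) {x y : V} (hx : x ∈ K) (hy : y ∈ K) {c : ℝ}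
    (hc : coneRatio K x y < c) : c • y - x ∈ K := by
  convert hK.add_mem (hK.coneRatio_mem hx hy) (hK.smul_mem _ (sub_pos.2 hc) _ hy) using 1
  module

/-- A one-sided, multiplicative triangle inequality; the product with its reversal is the triangle
inequality of the Hilbert distance. -/
theorem coneRatio_le_mul (hK : IsSharpCone K f) {x y z : V} (hx : x ∈ K) (hy : y ∈ K)
    (hz : z ∈ K) : coneRatio K x z ≤ coneRatio K x y * coneRatio K y z := by
  refine hK.coneRatio_le hx hz ?_
  convert hK.add_mem_closure (hK.smul_mem_closure (hK.coneRatio_pos hx hy).le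
    (hK.coneRatio_mem hy hz)) (hK.coneRatio_mem hx hy) using 1
  module

theorem coneRatio_smul (hK : IsSharpCone K f) {x y : V} (hx : x ∈ K) (hy : y ∈ K) {c d : ℝ}
    (hc : 0 < c) (hd : 0 < d) :
    coneRatio K (c • x) (d • y) = c / d * coneRatio K x y := by
  refine coneRatio_eq ?_ fun e he => ?_
  · convert hK.smul_mem_closure hc.le (hK.coneRatio_mem hx hy) using 1
    match_scalars <;> field_simp
  · have h := hK.smul_mem_closure (inv_nonneg.2 hc.le) he
    have := hK.coneRatio_le hx hy (c := e * d / c) (by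
      convert h using 1
      match_scalars <;> field_simp)
    rw [le_div_iff₀ hc] at this
    rw [div_mul_eq_mul_div, div_le_iff₀ hd]
    linarith

theorem coneRatio_self (hK : IsSharpCone K f) {x : V} (hx : x ∈ K) : coneRatio K x x = 1 := by
  refine coneRatio_eq (by simpa using hK.zero_mem_closure) fun c hc => ?_
  have h := hK.nonneg_closure hc
  rw [map_sub, map_smul, smul_eq_mul] at h
  have := hK.pos x hx
  nlinarith

theorem one_lt_coneRatio (hK : IsSharpCone K f) {x y : V} (hx : x ∈ K) (hy : y ∈ K)
    (hfx : f x = 1) (hfy : f y = 1) (hne : x ≠ y) : 1 < coneRatio K x y := by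
  have hmem := hK.coneRatio_mem hx hy
  have h := hK.nonneg_closure hmem
  rw [map_sub, map_smul, smul_eq_mul, hfx, hfy, mul_one, sub_nonneg] at h
  refine lt_of_le_of_ne h fun h1 => ?_
  rw [← h1, one_smul] at hmem
  have := hK.pos_closure _ hmem (sub_ne_zero.2 hne.symm)
  simp [hfx, hfy] at this

/-- For `t > 1` the point at parameter `t` is `(t - 1) • ((t / (t - 1)) • q - p)`. It is in the cone
when `t / (t - 1)` exceeds the ratio, and the ratio is at most `t / (t - 1)` when it is; solving for
`t` gives the end of the chord. -/
theorem isLUB_chord (hK : IsSharpCone K f) {p q : V} (hp : p ∈ K) (hq : q ∈ K)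
    (hfp : f p = 1) (hfq : f q = 1) (hne : p ≠ q) :
    IsLUB {t : ℝ | AffineMap.lineMap p q t ∈ {v | f v = 1 ∧ v ∈ K}}
      (coneRatio K p q / (coneRatio K p q - 1)) := by
  have hl := hK.one_lt_coneRatio hp hq hfp hfq hne
  set l := coneRatio K p q
  have hl1 : 0 < l - 1 := sub_pos.2 hl
  have h1 : 1 < l / (l - 1) := by rw [lt_div_iff₀ hl1]; linarith
  have hline : ∀ t : ℝ, 1 < t →
      AffineMap.lineMap p q t = (t - 1) • ((t / (t - 1)) • q - p) := by
    intro t ht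
    have : t - 1 ≠ 0 := (sub_pos.2 ht).ne'
    rw [AffineMap.lineMap_apply_module]
    match_scalars <;> field_simp
    ring
  have hf : ∀ t : ℝ, f (AffineMap.lineMap p q t) = 1 := by
    intro t
    rw [AffineMap.lineMap_apply_module]
    simp [hfp, hfq]
  constructor
  · rintro t ⟨-, ht⟩
    rcases le_or_gt t 1 with h | h
    · linarith
    · have ht1 := sub_pos.2 h
      rw [hline t h] at ht
      have h2 := hK.smul_mem _ (inv_pos.2 ht1) _ ht
      rw [inv_smul_smul₀ ht1.ne'] at h2
      have h3 := hK.coneRatio_le hp hq (subset_closure h2)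
      rw [le_div_iff₀ ht1] at h3
      rw [le_div_iff₀ hl1]
      linarith
  · intro b hb
    refine le_of_forall_lt_imp_le_of_dense fun c hc => ?_
    obtain ⟨t, ht1, ht2⟩ := exists_between (max_lt hc h1)
    have ht : 1 < t := (le_max_right _ _).trans_lt ht1
    refine ((le_max_left _ _).trans ht1.le).trans (hb ⟨hf t, ?_⟩)
    rw [hline t ht]
    refine hK.smul_mem _ (sub_pos.2 ht) _ (hK.mem_of_coneRatio_lt hp hq ?_)
    rw [lt_div_iff₀ hl1] at ht2
    rw [lt_div_iff₀ (sub_pos.2 ht)]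
    linarith

/-- The Hilbert distance of a plane section of a cone in terms of the order of the cone. -/
theorem hilbertDist_eq (hK : IsSharpCone K f) {p q : V} (hp : p ∈ K) (hq : q ∈ K)
    (hfp : f p = 1) (hfq : f q = 1) :
    hilbertDist {v | f v = 1 ∧ v ∈ K} p q =
      1 / 2 * Real.log (coneRatio K p q * coneRatio K q p) := by
  rw [hilbertDist]
  split_ifs with hpq
  · subst hpq
    simp [hK.coneRatio_self hp]
  · have h1 := hK.isLUB_chord hp hq hfp hfq hpq
    have h2 := hK.isLUB_chord hq hp hfq hfp (Ne.symm hpq)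
    -- The other end of the chord comes from `h2` by reversing the line, `t ↦ 1 - t`.
    have h3 : IsGLB {t : ℝ | AffineMap.lineMap p q t ∈ {v | f v = 1 ∧ v ∈ K}}
        (1 - coneRatio K q p / (coneRatio K q p - 1)) := by
      constructor
      · intro t ht
        have hmem : 1 - t ∈ {t : ℝ | AffineMap.lineMap q p t ∈ {v | f v = 1 ∧ v ∈ K}} := by
          rw [Set.mem_ofPred_eq, AffineMap.lineMap_apply_one_sub]
          exact ht
        have := h2.1 hmem
        linarith
      · intro b hb
        have hmem : 1 - b ∈ upperBounds
            {t : ℝ | AffineMap.lineMap q p t ∈ {v | f v = 1 ∧ v ∈ K}} := by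
          intro t ht
          have hmem : 1 - t ∈ {t : ℝ | AffineMap.lineMap p q t ∈ {v | f v = 1 ∧ v ∈ K}} := by
            rw [Set.mem_ofPred_eq, AffineMap.lineMap_apply_one_sub]
            exact ht
          linarith [hb hmem]
        linarith [h2.2 hmem]
    have hne : {t : ℝ | AffineMap.lineMap p q t ∈ {v | f v = 1 ∧ v ∈ K}}.Nonempty :=
      ⟨0, by simp [hfp, hp]⟩
    rw [chordStart, chordEnd, h1.csSup_eq hne, h3.csInf_eq hne]
    have hl := sub_pos.2 (hK.one_lt_coneRatio hp hq hfp hfq hpq)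
    have hm := sub_pos.2 (hK.one_lt_coneRatio hq hp hfq hfp (Ne.symm hpq))
    have hl0 := hK.coneRatio_pos hp hq
    have hm0 := hK.coneRatio_pos hq hp
    have hd : 0 < dist p q := dist_pos.2 hpq
    set l := coneRatio K p q
    set m := coneRatio K q p
    simp only [dist_right_lineMap, dist_left_lineMap, Real.norm_eq_abs]
    -- The two quotients of the cross-ratio simplify to `m` and `l`.
    have e1 : |1 - (1 - m / (m - 1))| = m / (m - 1) := by
      rw [sub_sub_cancel, abs_of_pos (by positivity)]
    have e2 : |1 - m / (m - 1)| = 1 / (m - 1) := by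
      rw [one_sub_div hm.ne', abs_div, abs_of_pos hm]
      congr 1
      rw [show m - 1 - m = -1 by ring]; simp
    have e3 : |l / (l - 1)| = l / (l - 1) := abs_of_pos (by positivity)
    have e4 : |1 - l / (l - 1)| = 1 / (l - 1) := by
      rw [one_sub_div hl.ne', abs_div, abs_of_pos hl]
      congr 1
      rw [show l - 1 - l = -1 by ring]; simp
    rw [e1, e2, e3, e4]
    congr 2
    field_simp

/-- The best factors are the two cone ratios. Allowing arbitrary `a` and `b` leaves closed
conditions on vectors, the form used in `IsThinCone`. -/
theorem hilbertDist_le_iff (hK : IsSharpCone K f) {p q : V} (hp : p ∈ K) (hq : q ∈ K)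
    (hfp : f p = 1) (hfq : f q = 1) {δ : ℝ} :
    hilbertDist {v | f v = 1 ∧ v ∈ K} p q ≤ δ ↔
      ∃ a b : ℝ, a * b ≤ Real.exp (2 * δ) ∧ a • q - p ∈ closure K ∧ b • p - q ∈ closure K := by
  have h1 := hK.coneRatio_pos hp hq
  have h2 := hK.coneRatio_pos hq hp
  have key : hilbertDist {v | f v = 1 ∧ v ∈ K} p q ≤ δ ↔
      coneRatio K p q * coneRatio K q p ≤ Real.exp (2 * δ) := by
    rw [hK.hilbertDist_eq hp hq hfp hfq, ← Real.log_le_iff_le_exp (mul_pos h1 h2)]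
    constructor <;> intro h <;> linarith
  rw [key]
  constructor
  · exact fun h => ⟨_, _, h, hK.coneRatio_mem hp hq, hK.coneRatio_mem hq hp⟩
  · rintro ⟨a, b, hab, ha, hb⟩
    refine le_trans ?_ hab
    have := hK.coneRatio_le hp hq ha
    have := hK.coneRatio_le hq hp hb
    gcongr
    linarith

/-- A point of a section through which equality holds in the triangle inequality lies on the
segment, if the cone is strictly convex. -/
theorem mem_segment_of_coneRatio_eq (hK : IsSharpCone K f) {R : ℝ} (hthin : IsThinCone R K)
    {x w y : V} (hx : x ∈ K) (hw : w ∈ K) (hy : y ∈ K) (hfx : f x = 1) (hfw : f w = 1)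
    (hfy : f y = 1) (h : coneRatio K x w * coneRatio K w y ≤ coneRatio K x y) :
    w ∈ segment ℝ x y := by
  rcases eq_or_ne x w with rfl | hxw
  · exact left_mem_segment ℝ _ _
  rcases eq_or_ne w y with rfl | hwy
  · exact right_mem_segment ℝ _ _
  have h := le_antisymm h (hK.coneRatio_le_mul hx hw hy)
  have h1 := sub_pos.2 (hK.one_lt_coneRatio hx hw hfx hfw hxw)
  have h2 := sub_pos.2 (hK.one_lt_coneRatio hw hy hfw hfy hwy)
  have hP := hK.coneRatio_mem hx hw
  have hQ := hK.coneRatio_mem hw hy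
  -- A functional supporting the cone at `(a * b) • y - x` vanishes on both summands of `hsum`. By
  -- strict convexity the chord ends `a • w - x` and `b • y - w` span the same ray, so `x`, `w`, `y`
  -- are collinear.
  obtain ⟨φ, hφ, hφ0⟩ := hK.exists_functional (hK.coneRatio_notMem hx hy)
  rw [← h] at hφ0
  set a := coneRatio K x w
  set b := coneRatio K w y
  have hφP := nonneg_closure_of_pos hφ hP
  have hφQ := nonneg_closure_of_pos hφ hQ
  have hsum : (a * b) • y - x = a • (b • y - w) + (a • w - x) := by module
  rw [hsum, map_add, map_smul, smul_eq_mul] at hφ0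
  have hφQ0 : φ (b • y - w) = 0 := by nlinarith
  have hφP0 : φ (a • w - x) = 0 := by nlinarith
  have heq := hK.eq_of_isThinCone hthin hφ (hK.smul_mem_closure (inv_nonneg.2 h1.le) hP)
    (hK.smul_mem_closure (inv_nonneg.2 h2.le) hQ)
    (by rw [map_smul, map_sub, map_smul, hfw, hfx, smul_eq_mul, smul_eq_mul, mul_one,
      inv_mul_cancel₀ h1.ne'])
    (by rw [map_smul, map_sub, map_smul, hfw, hfy, smul_eq_mul, smul_eq_mul, mul_one,
      inv_mul_cancel₀ h2.ne'])
    (by rw [map_smul, hφP0, smul_zero]) (by rw [map_smul, hφQ0, smul_zero])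
  have hab : 0 < a * b - 1 := by nlinarith
  refine ⟨(b - 1) / (a * b - 1), (a - 1) * b / (a * b - 1), by positivity, ?_, ?_, ?_⟩
  · have : 0 < b := by linarith
    positivity
  · rw [← add_div, div_eq_one_iff_eq hab.ne']
    ring
  · have h3 : ((a - 1) * (b - 1)) • ((a - 1)⁻¹ • (a • w - x)) =
        ((a - 1) * (b - 1)) • ((b - 1)⁻¹ • (b • y - w)) := by rw [heq]
    have h4 : (b - 1) • (a • w - x) = (a - 1) • (b • y - w) := by
      convert h3 using 1 <;> rw [smul_smul] <;> congr 1 <;> field_simp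
    have h5 : (a * b - 1) • w = (b - 1) • x + ((a - 1) * b) • y := by
      have : (a * b - 1) • w = (b - 1) • (a • w - x) + (b - 1) • x + (a - 1) • w := by module
      rw [this, h4]
      module
    rw [← inv_smul_smul₀ hab.ne' w, h5, smul_add, smul_smul, smul_smul]
    congr 2 <;> ring

/-- Segments are geodesics of the Hilbert geometry. -/
theorem isHilbertGeodesic_segment (hK : IsSharpCone K f) {x y : V} (hx : x ∈ K) (hy : y ∈ K)
    (hfx : f x = 1) (hfy : f y = 1) :
    IsHilbertGeodesic {v | f v = 1 ∧ v ∈ K} (segment ℝ x y) x y := by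
  rcases eq_or_ne x y with rfl | hxy
  · refine ⟨0, fun _ => x, le_rfl, rfl, rfl, by simp, by simp [hfx, hx], fun s hs t ht => ?_⟩
    rw [Set.Icc_self, Set.mem_singleton_iff] at hs ht
    simp [hilbertDist, hs, ht]
  have hl := hK.one_lt_coneRatio hx hy hfx hfy hxy
  have hm := hK.one_lt_coneRatio hy hx hfy hfx hxy.symm
  have hA := hK.coneRatio_mem hx hy
  have hB := hK.coneRatio_mem hy hx
  obtain ⟨φ, hφ, hφA⟩ := hK.exists_functional (hK.coneRatio_notMem hx hy)
  obtain ⟨ψ, hψ, hψB⟩ := hK.exists_functional (hK.coneRatio_notMem hy hx)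
  set l := coneRatio K x y
  set m := coneRatio K y x
  have hlm : 0 < l * m - 1 := by nlinarith
  have hl0 : 0 < l := by linarith
  have hm0 : 0 < m := by linarith
  -- `A` and `B` span the rays at the two ends of the chord; `r • A + B` with `r > 0` runs through
  -- the rays of the open chord.
  set A := l • y - x with hAdef
  set B := m • x - y with hBdef
  have hxAB : A + l • B = (l * m - 1) • x := by rw [hAdef, hBdef]; module
  have hyAB : m • A + B = (l * m - 1) • y := by rw [hAdef, hBdef]; module
  have hQ : ∀ r : ℝ, 0 < r → r • A + B ∈ K := by
    intro r hr
    have hc : 0 < min r l⁻¹ := lt_min hr (by positivity)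
    have h1 : A + l • B ∈ K := by rw [hxAB]; exact hK.smul_mem _ hlm _ hx
    have h2 := hK.smul_mem_closure (sub_nonneg.2 (min_le_left r l⁻¹)) hA
    have h3 := hK.smul_mem_closure (c := 1 - min r l⁻¹ * l) (sub_nonneg.2 (by
      rw [← le_div_iff₀ hl0, one_div]
      exact min_le_right _ _)) hB
    convert hK.add_mem (hK.add_mem_closure h2 h3) (hK.smul_mem _ hc _ h1) using 1
    module
  have hφA0 : φ A = 0 := le_antisymm hφA (nonneg_closure_of_pos hφ hA)
  have hψB0 : ψ B = 0 := le_antisymm hψB (nonneg_closure_of_pos hψ hB)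
  have hφB : 0 < φ B := by
    simpa [hφA0] using hφ _ (hQ 1 one_pos)
  have hψA : 0 < ψ A := by
    simpa [hψB0] using hψ _ (hQ 1 one_pos)
  -- In the plane of `A` and `B` the closed cone is the quadrant they span: `φ` and `ψ` read off the
  -- signs of the coefficients of `B` and `A`.
  have hratio : ∀ r s : ℝ, 0 < r → 0 < s →
      coneRatio K (r • A + B) (s • A + B) = max 1 (r / s) := by
    intro r s hr hs
    have hsub : ∀ c : ℝ, c • (s • A + B) - (r • A + B) = (c * s - r) • A + (c - 1) • B := by
      intro c; module
    refine coneRatio_eq ?_ fun c hc => max_le ?_ ?_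
    · rw [hsub]
      refine hK.add_mem_closure (hK.smul_mem_closure ?_ hA) (hK.smul_mem_closure ?_ hB)
      · rw [sub_nonneg, ← div_le_iff₀ hs]; exact le_max_right _ _
      · rw [sub_nonneg]; exact le_max_left _ _
    · have := nonneg_closure_of_pos hφ hc
      rw [hsub, map_add, map_smul, map_smul, hφA0, smul_zero, zero_add, smul_eq_mul] at this
      linarith [nonneg_of_mul_nonneg_left this hφB]
    · have := nonneg_closure_of_pos hψ hc
      rw [hsub, map_add, map_smul, map_smul, hψB0, smul_zero, add_zero, smul_eq_mul] at this
      rw [div_le_iff₀ hs]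
      linarith [nonneg_of_mul_nonneg_left this hψA]
  -- The coefficient `exp (2 * s) / l` starts at `1 / l`, on the ray of `x`, and ends at `m`, on the
  -- ray of `y`. The distance of two points is half the absolute logarithm of the quotient of their
  -- coefficients.
  set γ : ℝ → V := fun s => (f ((Real.exp (2 * s) / l) • A + B))⁻¹ •
    ((Real.exp (2 * s) / l) • A + B) with hγ
  have hr : ∀ s, 0 < Real.exp (2 * s) / l := fun s => by positivity
  have hγK : ∀ s, γ s ∈ K := fun s =>
    hK.smul_mem _ (inv_pos.2 (hK.pos _ (hQ _ (hr s)))) _ (hQ _ (hr s))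
  have hγf : ∀ s, f (γ s) = 1 := fun s => by
    rw [hγ, map_smul, smul_eq_mul, inv_mul_cancel₀ (hK.pos _ (hQ _ (hr s))).ne']
  have hdist : ∀ s t, s ≤ t → hilbertDist {v | f v = 1 ∧ v ∈ K} (γ s) (γ t) = t - s ∧
      hilbertDist {v | f v = 1 ∧ v ∈ K} (γ t) (γ s) = t - s := by
    intro s t hst
    have e1 : Real.exp (2 * s) / l / (Real.exp (2 * t) / l) = Real.exp (2 * (s - t)) := by
      rw [div_div_div_cancel_right₀ hl0.ne', ← Real.exp_sub]; ring_nf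
    have e2 : Real.exp (2 * t) / l / (Real.exp (2 * s) / l) = Real.exp (2 * (t - s)) := by
      rw [div_div_div_cancel_right₀ hl0.ne', ← Real.exp_sub]; ring_nf
    have hfs := hK.pos _ (hQ _ (hr s))
    have hft := hK.pos _ (hQ _ (hr t))
    have key : coneRatio K (γ s) (γ t) * coneRatio K (γ t) (γ s) = Real.exp (2 * (t - s)) := by
      simp only [hγ]
      rw [hK.coneRatio_smul (hQ _ (hr s)) (hQ _ (hr t)) (inv_pos.2 hfs) (inv_pos.2 hft),
        hK.coneRatio_smul (hQ _ (hr t)) (hQ _ (hr s)) (inv_pos.2 hft) (inv_pos.2 hfs),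
        hratio _ _ (hr s) (hr t), hratio _ _ (hr t) (hr s), e1, e2,
        max_eq_left (Real.exp_le_one_iff.2 (by linarith)),
        max_eq_right (Real.one_le_exp (by linarith))]
      field_simp
    rw [hK.hilbertDist_eq (hγK s) (hγK t) (hγf s) (hγf t),
      hK.hilbertDist_eq (hγK t) (hγK s) (hγf t) (hγf s), mul_comm (coneRatio K (γ t) (γ s)), key,
      Real.log_exp]
    constructor <;> ring
  have hexp : Real.exp (2 * (1 / 2 * Real.log (l * m))) = l * m := by
    rw [← mul_assoc, mul_one_div_cancel two_ne_zero, one_mul, Real.exp_log (by positivity)]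
  have hnorm : ∀ (c : ℝ) (v : V), 0 < c → f v = 1 → (f (c • v))⁻¹ • c • v = v := by
    intro c v hc hv
    rw [map_smul, hv, smul_eq_mul, mul_one, inv_smul_smul₀ hc.ne']
  refine ⟨1 / 2 * Real.log (l * m), γ, ?_, ?_, ?_, ?_, ?_, ?_⟩
  · have := Real.log_nonneg (by nlinarith : 1 ≤ l * m)
    positivity
  · have : (Real.exp (2 * 0) / l) • A + B = ((l * m - 1) / l) • x := by
      rw [hAdef, hBdef, mul_zero, Real.exp_zero]
      match_scalars <;> field_simp <;> ring
    rw [hγ]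
    simp only [this]
    exact hnorm _ _ (by positivity) hfx
  · have : (l * m / l) • A + B = (l * m - 1) • y := by
      rw [mul_div_cancel_left₀ _ hl0.ne', hyAB]
    rw [hγ]
    simp only [hexp, this]
    exact hnorm _ _ hlm hfy
  · ext v
    constructor
    · rintro ⟨a, b, ha, hb, hab, rfl⟩
      have hc : 0 < a + b * m := by
        rcases ha.eq_or_lt with rfl | ha
        · rw [zero_add] at hab; subst hab; linarith
        · positivity
      have hd : 0 < a * l + b := by
        rcases ha.eq_or_lt with rfl | ha
        · rw [zero_add] at hab; subst hab; linarith
        · positivity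
      set r := (a + b * m) / (a * l + b) with hrdef
      have hr0 : 0 < r * l := by positivity
      have hexp' : Real.exp (2 * (1 / 2 * Real.log (r * l))) = r * l := by
        rw [← mul_assoc, mul_one_div_cancel two_ne_zero, one_mul, Real.exp_log hr0]
      have hge : 1 ≤ r * l := by
        rw [hrdef, div_mul_eq_mul_div, le_div_iff₀ hd]
        nlinarith
      have hle : r * l ≤ l * m := by
        rw [mul_comm]
        gcongr
        rw [hrdef, div_le_iff₀ hd]
        nlinarith
      refine ⟨1 / 2 * Real.log (r * l), ⟨?_, ?_⟩, ?_⟩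
      · have := Real.log_nonneg hge
        positivity
      · have := Real.log_le_log hr0 hle
        linarith
      · have : (r * l / l) • A + B = ((l * m - 1) / (a * l + b)) • (a • x + b • y) := by
          rw [mul_div_cancel_right₀ _ hl0.ne', hAdef, hBdef, hrdef]
          match_scalars <;> field_simp <;> ring
        rw [hγ]
        simp only [hexp', this]
        exact hnorm _ _ (by positivity) (by simp [hfx, hfy, hab])
    · rintro ⟨s, hs, rfl⟩
      set r := Real.exp (2 * s) / l with hrdef
      have h1 : 1 ≤ r * l := by
        rw [hrdef, div_mul_cancel₀ _ hl0.ne']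
        exact Real.one_le_exp (by linarith [hs.1])
      have h2 : r ≤ m := by
        rw [hrdef, div_le_iff₀ hl0, ← Real.le_log_iff_exp_le (by positivity), mul_comm m]
        linarith [hs.2]
      have hQr : r • A + B = (m - r) • x + (r * l - 1) • y := by
        rw [hAdef, hBdef]; module
      have hfQ : f (r • A + B) = (m - r) + (r * l - 1) := by
        rw [hQr]; simp [hfx, hfy]
      have hfpos := hK.pos _ (hQ _ (hr s))
      rw [hfQ] at hfpos
      refine ⟨(m - r) / ((m - r) + (r * l - 1)), (r * l - 1) / ((m - r) + (r * l - 1)),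
        div_nonneg (by linarith) hfpos.le, div_nonneg (by linarith) hfpos.le, ?_, ?_⟩
      · rw [← add_div, div_self hfpos.ne']
      · rw [hγ]
        simp only
        rw [hfQ, hQr, smul_add, smul_smul, smul_smul]
        congr 2 <;> ring
  · exact fun v hv => ⟨by
      obtain ⟨a, b, ha, hb, hab, rfl⟩ := hv
      simp [hfx, hfy, hab], hK.convex.segment_subset hx hy hv⟩
  · intro s _ t _
    rcases le_total s t with h | h
    · rw [(hdist s t h).1, abs_sub_comm, abs_of_nonneg (sub_nonneg.2 h)]
    · rw [(hdist t s h).2, abs_of_nonneg (sub_nonneg.2 h)]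

theorem coneRatio_mul_eq_exp (hK : IsSharpCone K f) {p q : V} (hp : p ∈ K) (hq : q ∈ K)
    (hfp : f p = 1) (hfq : f q = 1) :
    coneRatio K p q * coneRatio K q p =
      Real.exp (2 * hilbertDist {v | f v = 1 ∧ v ∈ K} p q) := by
  rw [hK.hilbertDist_eq hp hq hfp hfq, ← mul_assoc, mul_one_div_cancel two_ne_zero, one_mul,
    Real.exp_log (mul_pos (hK.coneRatio_pos hp hq) (hK.coneRatio_pos hq hp))]

/-- In a section of a thin cone, segments are the only geodesics of the Hilbert geometry. -/
theorem eq_segment_of_isHilbertGeodesic (hK : IsSharpCone K f) {R : ℝ} (hthin : IsThinCone R K)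
    {S : Set V} {x y : V} (hS : IsHilbertGeodesic {v | f v = 1 ∧ v ∈ K} S x y) :
    S = segment ℝ x y := by
  obtain ⟨l, γ, hl, hγ0, hγl, rfl, hsub, hd⟩ := hS
  have hmem : ∀ s ∈ Set.Icc 0 l, f (γ s) = 1 ∧ γ s ∈ K := fun s hs => hsub ⟨s, hs, rfl⟩
  have h0 : (0 : ℝ) ∈ Set.Icc 0 l := ⟨le_rfl, hl⟩
  have hl' : l ∈ Set.Icc 0 l := ⟨hl, le_rfl⟩
  obtain ⟨hfx, hx⟩ := hγ0 ▸ hmem 0 h0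
  obtain ⟨hfy, hy⟩ := hγl ▸ hmem l hl'
  have hseg : ∀ s ∈ Set.Icc 0 l, γ s ∈ segment ℝ x y := by
    intro s hs
    obtain ⟨hfw, hw⟩ := hmem s hs
    refine hK.mem_segment_of_coneRatio_eq hthin hx hw hy hfx hfw hfy ?_
    have e1 := hK.coneRatio_mul_eq_exp hx hw hfx hfw
    have e2 := hK.coneRatio_mul_eq_exp hw hy hfw hfy
    have e3 := hK.coneRatio_mul_eq_exp hx hy hfx hfy
    have d1 : hilbertDist {v | f v = 1 ∧ v ∈ K} x (γ s) = s := by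
      rw [← hγ0, hd 0 h0 s hs, zero_sub, abs_neg, abs_of_nonneg hs.1]
    have d2 : hilbertDist {v | f v = 1 ∧ v ∈ K} (γ s) y = l - s := by
      rw [← hγl, hd s hs l hl', abs_sub_comm, abs_of_nonneg (sub_nonneg.2 hs.2)]
    have d3 : hilbertDist {v | f v = 1 ∧ v ∈ K} x y = l := by
      rw [← hγ0, ← hγl, hd 0 h0 l hl', zero_sub, abs_neg, abs_of_nonneg hl]
    rw [d1] at e1
    rw [d2] at e2
    rw [d3, show 2 * l = 2 * s + 2 * (l - s) by ring, Real.exp_add, ← e1, ← e2] at e3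
    -- Along a geodesic the product of the triangle inequalities in both directions is an equality.
    -- Cancelling the reversed one yields the inequality that forces `γ s` onto the segment.
    have t2 := hK.coneRatio_le_mul hy hw hx
    have p1 := hK.coneRatio_pos hx hy
    have p2 := hK.coneRatio_pos hy hx
    refine le_of_mul_le_mul_right ?_ p2
    rw [e3]
    have p3 := hK.coneRatio_pos hx hw
    have p4 := hK.coneRatio_pos hw hy
    calc _ ≤ coneRatio K x (γ s) * coneRatio K (γ s) y *
          (coneRatio K y (γ s) * coneRatio K (γ s) x) := by gcongr
      _ = _ := by ring
  refine Set.Subset.antisymm ?_ ?_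
  · rintro _ ⟨s, hs, rfl⟩
    exact hseg s hs
  -- The segment is itself a geodesic `σ` of the same length. A point `γ s` on it has distance `s`
  -- from `x`, so it can only be `σ s`; hence `γ` reaches every point of the segment.
  · intro q hq
    obtain ⟨l', σ, hl'', hσ0, hσl, himg, -, hσ⟩ := hK.isHilbertGeodesic_segment hx hy hfx hfy
    have hll : l = l' := by
      have a1 := hd 0 h0 l hl'
      have a2 := hσ 0 ⟨le_rfl, hl''⟩ l' ⟨hl'', le_rfl⟩
      rw [hγ0, hγl, zero_sub, abs_neg, abs_of_nonneg hl] at a1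
      rw [hσ0, hσl, zero_sub, abs_neg, abs_of_nonneg hl''] at a2
      rw [← a1, a2]
    subst hll
    rw [himg] at hq
    obtain ⟨s, hs, rfl⟩ := hq
    obtain ⟨t, ht, hts⟩ : γ s ∈ σ '' Set.Icc 0 l := himg ▸ hseg s hs
    have a1 := hd 0 h0 s hs
    have a2 := hσ 0 h0 t ht
    rw [hσ0, hts, ← hγ0, a1] at a2
    simp only [zero_sub, abs_neg, abs_of_nonneg hs.1, abs_of_nonneg ht.1] at a2
    exact ⟨s, hs, by rw [← hts, a2]⟩

end IsSharpCone

/-- Rescaling the ends of a segment only rescales its points and changes their weights, so triangles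
in a cone may be normalized to a section. -/
theorem exists_smul_mem_segment {x y q : V} {c d : ℝ} (hc : 0 < c) (hd : 0 < d)
    (hq : q ∈ segment ℝ (c • x) (d • y)) : ∃ s : ℝ, 0 < s ∧ s • q ∈ segment ℝ x y := by
  obtain ⟨a, b, ha, hb, hab, rfl⟩ := hq
  have h : 0 < a * c + b * d := by
    rcases ha.eq_or_lt with rfl | ha
    · rw [zero_add] at hab; subst hab; simpa using hd
    · positivity
  refine ⟨(a * c + b * d)⁻¹, by positivity, a * c / (a * c + b * d), b * d / (a * c + b * d),
    by positivity, by positivity, by field_simp, ?_⟩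
  match_scalars <;> field_simp

/-- The Hilbert geometry of a section of a sharp cone is `δ`-hyperbolic if and only if the cone is
thin. -/
theorem IsSharpCone.isHilbertHyperbolic_iff {K : Set V} {f : Module.Dual ℝ V}
    (hK : IsSharpCone K f) {δ : ℝ} :
    IsHilbertHyperbolic δ {v | f v = 1 ∧ v ∈ K} ↔ IsThinCone (Real.exp (2 * δ)) K := by
  constructor
  -- The vertices are scaled into `{f = 1}`, where the straight sides are geodesics.
  · intro h x hx y hy z hz p hp
    have norm : ∀ v ∈ K, (f v)⁻¹ • v ∈ K ∧ f ((f v)⁻¹ • v) = 1 := fun v hv =>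
      ⟨hK.smul_mem _ (inv_pos.2 (hK.pos v hv)) v hv, by
        rw [map_smul, smul_eq_mul, inv_mul_cancel₀ (hK.pos v hv).ne']⟩
    obtain ⟨hx', hfx⟩ := norm x hx
    obtain ⟨hy', hfy⟩ := norm y hy
    obtain ⟨hz', hfz⟩ := norm z hz
    have ix := inv_pos.2 (hK.pos x hx)
    have iy := inv_pos.2 (hK.pos y hy)
    have iz := inv_pos.2 (hK.pos z hz)
    obtain ⟨s, hs, hsp⟩ : ∃ s : ℝ, 0 < s ∧
        s • p ∈ segment ℝ ((f x)⁻¹ • x) ((f y)⁻¹ • y) := by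
      refine exists_smul_mem_segment (inv_pos.2 ix) (inv_pos.2 iy) ?_
      rwa [inv_smul_smul₀ ix.ne', inv_smul_smul₀ iy.ne']
    obtain ⟨q, hq, hd⟩ := h _ _ _ _ _ _ (hK.isHilbertGeodesic_segment hy' hz' hfy hfz)
      (hK.isHilbertGeodesic_segment hz' hx' hfz hfx)
      (hK.isHilbertGeodesic_segment hx' hy' hfx hfy) (s • p) hsp
    have hseg1 : ∀ {u v w : V}, u ∈ K → v ∈ K → f u = 1 → f v = 1 → w ∈ segment ℝ u v →
        f w = 1 := by
      rintro u v w - - hu hv ⟨a, b, -, -, hab, rfl⟩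
      simp [hu, hv, hab]
    have hqK : q ∈ K ∧ f q = 1 := hq.elim
      (fun hq => ⟨hK.convex.segment_subset hy' hz' hq, hseg1 hy' hz' hfy hfz hq⟩)
      (fun hq => ⟨hK.convex.segment_subset hz' hx' hq, hseg1 hz' hx' hfz hfx hq⟩)
    rw [hK.hilbertDist_le_iff (hK.convex.segment_subset hx' hy' hsp) hqK.1
      (hseg1 hx' hy' hfx hfy hsp) hqK.2] at hd
    obtain ⟨a, b, hab, h1, h2⟩ := hd
    obtain ⟨t, ht, htq⟩ : ∃ t : ℝ, 0 < t ∧ t • q ∈ segment ℝ y z ∪ segment ℝ z x :=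
      hq.elim (fun hq => (exists_smul_mem_segment iy iz hq).imp fun t ht => ⟨ht.1, Or.inl ht.2⟩)
        (fun hq => (exists_smul_mem_segment iz ix hq).imp fun t ht => ⟨ht.1, Or.inr ht.2⟩)
    -- Undoing the normalization changes `a` and `b` by inverse factors and keeps their product.
    refine ⟨t • q, htq, a / (s * t), b * (s * t), ?_, ?_, ?_⟩
    · have : a / (s * t) * (b * (s * t)) = a * b := by field_simp
      rwa [this]
    · convert hK.smul_mem_closure (inv_nonneg.2 hs.le) h1 using 1
      match_scalars <;> field_simp
    · convert hK.smul_mem_closure ht.le h2 using 1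
      match_scalars <;> field_simp
  -- Thinness gives strict convexity, so the sides of any geodesic triangle are segments.
  · intro h x y z A B S hA hB hS p hp
    have hmem : ∀ {u v : V} {S : Set V}, IsHilbertGeodesic {v | f v = 1 ∧ v ∈ K} S u v →
        (f u = 1 ∧ u ∈ K) ∧ ∀ w ∈ S, f w = 1 ∧ w ∈ K := by
      rintro u v _ ⟨l, γ, hl, rfl, rfl, rfl, hsub, -⟩
      exact ⟨hsub ⟨0, ⟨le_rfl, hl⟩, rfl⟩, fun w hw => hsub hw⟩
    obtain ⟨⟨-, hy⟩, hA'⟩ := hmem hA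
    obtain ⟨⟨-, hz⟩, hB'⟩ := hmem hB
    obtain ⟨⟨-, hx⟩, hS'⟩ := hmem hS
    have hp' := hS' p hp
    rw [hK.eq_segment_of_isHilbertGeodesic h hS] at hp
    obtain ⟨q, hq, a, b, hab⟩ := h x hx y hy z hz p hp
    rw [← hK.eq_segment_of_isHilbertGeodesic h hA, ← hK.eq_segment_of_isHilbertGeodesic h hB] at hq
    have hq' := hq.elim (hA' q) (hB' q)
    exact ⟨q, hq, (hK.hilbertDist_le_iff hp'.2 hq'.2 hp'.1 hq'.1).2 ⟨a, b, hab⟩⟩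

end HilbertCones

/-! ### Domains of the projective plane and the cones over them -/

section ProjectivePlane

theorem isometry_projectionMatrix : Isometry projectionMatrix :=
  Isometry.of_dist_eq fun _ _ => rfl

theorem projectionMatrix_mk (v : Fin 3 → ℝ) (hv : v ≠ 0) (i j : Fin 3) :
    projectionMatrix (Projectivization.mk ℝ v hv) (i, j) = v i * v j / (v ⬝ᵥ v) := rfl

theorem dotProduct_self_pos {v : Fin 3 → ℝ} (hv : v ≠ 0) : 0 < v ⬝ᵥ v :=
  lt_of_le_of_ne (Finset.sum_nonneg fun i _ => mul_self_nonneg (v i))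
    (Ne.symm (by simpa [dotProduct_self_eq_zero] using hv))

theorem continuous_projectivization_mk :
    Continuous fun v : {v : Fin 3 → ℝ // v ≠ 0} => (Projectivization.mk ℝ v.1 v.2 : P2) := by
  rw [isometry_projectionMatrix.isUniformInducing.isInducing.continuous_iff]
  have hc : ∀ i, Continuous fun v : {v : Fin 3 → ℝ // v ≠ 0} => v.1 i := fun i =>
    (continuous_apply i).comp continuous_subtype_val
  have h : Continuous fun v : {v : Fin 3 → ℝ // v ≠ 0} =>
      (fun ij : Fin 3 × Fin 3 => v.1 ij.1 * v.1 ij.2 / (v.1 ⬝ᵥ v.1)) := by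
    refine continuous_pi fun ij => Continuous.div ?_ ?_ fun v => (dotProduct_self_pos v.2).ne'
    · exact (hc _).mul (hc _)
    · exact continuous_finsetSum _ fun i _ => (hc _).mul (hc _)
  exact (PiLp.continuous_toLp 2 _).comp h

theorem tendsto_projectivization_mk {v : ℕ → Fin 3 → ℝ} {w : Fin 3 → ℝ} (hv : ∀ n, v n ≠ 0)
    (hw : w ≠ 0) (h : Tendsto v atTop (𝓝 w)) :
    Tendsto (fun n => (Projectivization.mk ℝ (v n) (hv n) : P2)) atTop
      (𝓝 (Projectivization.mk ℝ w hw)) :=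
  (continuous_projectivization_mk.tendsto ⟨w, hw⟩).comp
    (f := fun n => (⟨v n, hv n⟩ : {v : Fin 3 → ℝ // v ≠ 0})) (tendsto_subtype_rng.2 h)

instance : CompactSpace P2 := by
  have hne : ∀ v : Metric.sphere (0 : Fin 3 → ℝ) 1, v.1 ≠ 0 := fun v h => by
    simpa [h] using v.2
  have hc : Continuous fun v : Metric.sphere (0 : Fin 3 → ℝ) 1 =>
      (Projectivization.mk ℝ v.1 (hne v) : P2) :=
    continuous_projectivization_mk.comp
      (f := fun v : Metric.sphere (0 : Fin 3 → ℝ) 1 => (⟨v.1, hne v⟩ : {v : Fin 3 → ℝ // v ≠ 0}))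
      (continuous_subtype_val.subtype_mk _)
  have hs : Function.Surjective fun v : Metric.sphere (0 : Fin 3 → ℝ) 1 =>
      (Projectivization.mk ℝ v.1 (hne v) : P2) := by
    intro p
    induction p using Projectivization.ind with | h v hv =>
    have h0 : ‖v‖ ≠ 0 := norm_ne_zero_iff.2 hv
    refine ⟨⟨‖v‖⁻¹ • v, by simp [norm_smul, h0]⟩, ?_⟩
    exact (Projectivization.mk_eq_mk_iff' ..).2 ⟨‖v‖⁻¹, rfl⟩
  exact ⟨by rw [← hs.range_eq]; exact isCompact_range hc⟩

/-- The image of `f` under the orthogonal projection onto the line `p`. -/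
noncomputable def chartVector (f : Module.Dual ℝ (Fin 3 → ℝ)) (p : P2) : Fin 3 → ℝ :=
  fun i => ∑ j, projectionMatrix p (i, j) * f (fun k => if j = k then 1 else 0)

/-- Entries of the projection matrix need no choice of representative; through them the affine
charts become continuous maps on the projective plane. -/
theorem continuous_chartVector (f : Module.Dual ℝ (Fin 3 → ℝ)) : Continuous (chartVector f) := by
  have h := isometry_projectionMatrix.continuous
  refine continuous_pi fun i => continuous_finsetSum _ fun j _ => ?_
  exact ((PiLp.continuous_apply 2 _ (i, j)).comp h).mul continuous_const

theorem chartVector_mk (f : Module.Dual ℝ (Fin 3 → ℝ)) {v : Fin 3 → ℝ} (hv : v ≠ 0) :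
    chartVector f (Projectivization.mk ℝ v hv) = (f v / (v ⬝ᵥ v)) • v := by
  ext i
  simp only [chartVector, projectionMatrix_mk, Pi.smul_apply, smul_eq_mul]
  rw [LinearMap.pi_apply_eq_sum_univ f v, Finset.sum_div, Finset.sum_mul]
  exact Finset.sum_congr rfl fun j _ => by rw [smul_eq_mul]; ring

/-- The representative of the point `p` in the affine plane `{f = 1}`. -/
noncomputable def chartSection (f : Module.Dual ℝ (Fin 3 → ℝ)) (p : P2) : Fin 3 → ℝ :=
  (f (chartVector f p))⁻¹ • chartVector f p

theorem apply_chartVector_mk (f : Module.Dual ℝ (Fin 3 → ℝ)) {v : Fin 3 → ℝ} (hv : v ≠ 0) :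
    f (chartVector f (Projectivization.mk ℝ v hv)) = f v * f v / (v ⬝ᵥ v) := by
  rw [chartVector_mk, map_smul, smul_eq_mul]; ring

theorem chartSection_mk (f : Module.Dual ℝ (Fin 3 → ℝ)) {v : Fin 3 → ℝ} (hv : v ≠ 0)
    (hfv : f v ≠ 0) : chartSection f (Projectivization.mk ℝ v hv) = (f v)⁻¹ • v := by
  have := (dotProduct_self_pos hv).ne'
  rw [chartSection, apply_chartVector_mk, chartVector_mk, smul_smul]
  congr 1
  field_simp

theorem continuousOn_chartSection (f : Module.Dual ℝ (Fin 3 → ℝ)) :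
    ContinuousOn (chartSection f) {p | f (chartVector f p) ≠ 0} :=
  ContinuousOn.smul (ContinuousOn.inv₀ (f.continuous_of_finiteDimensional.comp
    (continuous_chartVector f)).continuousOn fun _ h => h) (continuous_chartVector f).continuousOn

theorem apply_chartVector_ne_zero_iff (f : Module.Dual ℝ (Fin 3 → ℝ)) {v : Fin 3 → ℝ}
    (hv : v ≠ 0) : f (chartVector f (Projectivization.mk ℝ v hv)) ≠ 0 ↔ f v ≠ 0 := by
  rw [apply_chartVector_mk]
  simp [(dotProduct_self_pos hv).ne']

theorem tendsto_chartSection_mk {f : Module.Dual ℝ (Fin 3 → ℝ)} {p : ℕ → P2} {v : Fin 3 → ℝ}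
    {hv : v ≠ 0} (hfv : f v ≠ 0) (h : Tendsto p atTop (𝓝 (Projectivization.mk ℝ v hv))) :
    Tendsto (fun n => chartSection f (p n)) atTop (𝓝 ((f v)⁻¹ • v)) := by
  have hopen : IsOpen {p | f (chartVector f p) ≠ 0} := isOpen_ne_fun
    (f.continuous_of_finiteDimensional.comp (continuous_chartVector f)) continuous_const
  have := ((continuousOn_chartSection f).continuousAt (hopen.mem_nhds
    ((apply_chartVector_ne_zero_iff f hv).2 hfv))).tendsto.comp h
  rwa [chartSection_mk f hv hfv] at this

/-- The set of the lines spanned by the nonzero vectors of `D`. -/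
def projCone (D : Set (Fin 3 → ℝ)) : Set P2 :=
  {p | ∃ v ∈ D, ∃ hv : v ≠ 0, p = Projectivization.mk ℝ v hv}

theorem mk_mem_projCone {D : Set (Fin 3 → ℝ)} {f : Module.Dual ℝ (Fin 3 → ℝ)}
    (hsmul : ∀ c : ℝ, 0 < c → ∀ v ∈ D, c • v ∈ D) (hpos : ∀ v ∈ D, v ≠ 0 → 0 < f v)
    {v : Fin 3 → ℝ} (hv : v ≠ 0) (hfv : 0 < f v) :
    (Projectivization.mk ℝ v hv : P2) ∈ projCone D ↔ v ∈ D := by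
  constructor
  · rintro ⟨w, hw, hw0, h⟩
    obtain ⟨c, rfl⟩ := (Projectivization.mk_eq_mk_iff' ..).1 h
    have hfw := hpos w hw hw0
    rw [map_smul, smul_eq_mul] at hfv
    exact hsmul c (pos_of_mul_pos_left hfv hfw.le) w hw
  · exact fun h => ⟨v, h, hv, rfl⟩

theorem apply_rep_mk_ne_zero {f : Module.Dual ℝ (Fin 3 → ℝ)} {v : Fin 3 → ℝ} (hv : v ≠ 0) :
    f (Projectivization.mk ℝ v hv).rep ≠ 0 ↔ f v ≠ 0 := by
  obtain ⟨a, ha⟩ := Projectivization.exists_smul_eq_mk_rep ℝ v hv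
  rw [← ha, Units.smul_def, map_smul, smul_eq_mul]
  simp

namespace IsSharpCone

variable {K : Set (Fin 3 → ℝ)} {f : Module.Dual ℝ (Fin 3 → ℝ)}

theorem mk_mem_projCone (hK : IsSharpCone K f) {v : Fin 3 → ℝ} (hv : v ≠ 0) (hfv : 0 < f v) :
    (Projectivization.mk ℝ v hv : P2) ∈ projCone K ↔ v ∈ K :=
  _root_.mk_mem_projCone hK.smul_mem (fun v hv _ => hK.pos v hv) hv hfv

theorem mk_mem_projCone_closure (hK : IsSharpCone K f) {v : Fin 3 → ℝ} (hv : v ≠ 0)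
    (hfv : 0 < f v) :
    (Projectivization.mk ℝ v hv : P2) ∈ projCone (closure K) ↔ v ∈ closure K :=
  _root_.mk_mem_projCone (fun _ hc _ hv => hK.smul_mem_closure hc.le hv) hK.pos_closure hv hfv

theorem isOpen_projCone (hK : IsSharpCone K f) : IsOpen (projCone K) := by
  have hopen : IsOpen {p | f (chartVector f p) ≠ 0} := isOpen_ne_fun
    (f.continuous_of_finiteDimensional.comp (continuous_chartVector f)) continuous_const
  convert (continuousOn_chartSection f).isOpen_inter_preimage hopen hK.isOpen using 1
  ext p
  constructor
  · rintro ⟨v, hv, hv0, rfl⟩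
    have hfv := hK.pos v hv
    refine ⟨(apply_chartVector_ne_zero_iff f hv0).2 hfv.ne', ?_⟩
    rw [Set.mem_preimage, chartSection_mk f hv0 hfv.ne']
    exact hK.smul_mem _ (inv_pos.2 hfv) v hv
  · rintro ⟨h1, h2⟩
    induction p using Projectivization.ind with | h v hv =>
    have hfv := (apply_chartVector_ne_zero_iff f hv).1 h1
    rw [Set.mem_preimage, chartSection_mk f hv hfv] at h2
    refine ⟨_, h2, smul_ne_zero (inv_ne_zero hfv) hv, ?_⟩
    exact (Projectivization.mk_eq_mk_iff' ..).2 ⟨f v, smul_inv_smul₀ hfv v⟩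

theorem isCompact_slice_closure (hK : IsSharpCone K f) :
    IsCompact {v | f v = 1 ∧ v ∈ closure K} := by
  obtain ⟨c, hc, h⟩ := hK.exists_norm_le
  refine (isCompact_closedBall (0 : Fin 3 → ℝ) c⁻¹).of_isClosed_subset
    ((isClosed_eq f.continuous_of_finiteDimensional continuous_const).inter isClosed_closure) ?_
  rintro v ⟨h1, h2⟩
  have := h v h2
  rw [h1, mul_comm, ← le_div_iff₀ hc, one_div] at this
  simpa using this

/-- The right side is the continuous image of the compact slice `{f = 1}` of the closed cone, hence
closed. -/
theorem closure_projCone (hK : IsSharpCone K f) : closure (projCone K) = projCone (closure K) := by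
  refine Set.Subset.antisymm (closure_minimal ?_ ?_) ?_
  · rintro p ⟨v, hv, h⟩
    exact ⟨v, subset_closure hv, h⟩
  · have hne : ∀ v : {v | f v = 1 ∧ v ∈ closure K}, v.1 ≠ 0 := fun v h => by
      have := v.2.1
      rw [h, map_zero] at this
      exact zero_ne_one this
    have hc : Continuous fun v : {v | f v = 1 ∧ v ∈ closure K} =>
        (Projectivization.mk ℝ v.1 (hne v) : P2) :=
      continuous_projectivization_mk.comp
        (f := fun v : {v | f v = 1 ∧ v ∈ closure K} =>
          (⟨v.1, hne v⟩ : {v : Fin 3 → ℝ // v ≠ 0})) (continuous_subtype_val.subtype_mk _)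
    have : CompactSpace {v | f v = 1 ∧ v ∈ closure K} :=
      isCompact_iff_compactSpace.1 hK.isCompact_slice_closure
    convert (isCompact_range hc).isClosed using 1
    ext p
    constructor
    · rintro ⟨v, hv, hv0, rfl⟩
      have hfv := hK.pos_closure v hv hv0
      refine ⟨⟨(f v)⁻¹ • v, ?_, hK.smul_mem_closure (inv_nonneg.2 hfv.le) hv⟩, ?_⟩
      · rw [map_smul, smul_eq_mul, inv_mul_cancel₀ hfv.ne']
      · exact (Projectivization.mk_eq_mk_iff' ..).2 ⟨_, rfl⟩
    · rintro ⟨v, rfl⟩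
      exact ⟨v.1, v.2.2, hne v, rfl⟩
  · rintro p ⟨v, hv, hv0, rfl⟩
    obtain ⟨w, hw, hlim⟩ := mem_closure_iff_seq_limit.1 hv
    exact mem_closure_of_tendsto
      (tendsto_projectivization_mk (fun n => hK.ne_zero (hw n)) hv0 hlim)
      (.of_forall fun n => ⟨w n, hw n, hK.ne_zero (hw n), rfl⟩)

theorem mk_mem_frontier (hK : IsSharpCone K f) {v : Fin 3 → ℝ} (hv : v ≠ 0) (hfv : 0 < f v) :
    (Projectivization.mk ℝ v hv : P2) ∈ frontier (projCone K) ↔ v ∈ closure K ∧ v ∉ K := by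
  rw [hK.isOpen_projCone.frontier_eq, hK.closure_projCone, Set.mem_sdiff,
    hK.mk_mem_projCone hv hfv, hK.mk_mem_projCone_closure hv hfv]

theorem chartSlice_projCone (hK : IsSharpCone K f) :
    chartSlice (projCone K) f = {v | f v = 1 ∧ v ∈ K} := by
  ext v
  refine and_congr_right fun hfv => ?_
  have hv : v ≠ 0 := by
    rintro rfl
    simp at hfv
  exact ⟨fun ⟨_, h⟩ => (hK.mk_mem_projCone hv (hfv ▸ one_pos)).1 h,
    fun h => ⟨hv, (hK.mk_mem_projCone hv (hfv ▸ one_pos)).2 h⟩⟩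

theorem isConvexChart (hK : IsSharpCone K f) : IsConvexChart (projCone K) f where
  ne_zero := by
    rintro rfl
    obtain ⟨v, hv⟩ := hK.nonempty
    simpa using hK.pos v hv
  avoids := by
    rw [hK.closure_projCone]
    rintro p ⟨v, hv, hv0, rfl⟩
    exact (apply_rep_mk_ne_zero hv0).2 (hK.pos_closure v hv hv0).ne'
  convex := by
    rw [hK.chartSlice_projCone]
    exact (convex_hyperplane f.isLinear 1).inter hK.convex

theorem projCone_mem_hyperbolicDomains (hK : IsSharpCone K f) {δ : ℝ}
    (hthin : IsThinCone (Real.exp (2 * δ)) K) : projCone K ∈ hyperbolicDomains δ := by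
  refine ⟨⟨hK.isOpen_projCone, ?_, f, hK.isConvexChart⟩, f, hK.isConvexChart, ?_⟩
  · obtain ⟨v, hv⟩ := hK.nonempty
    exact ⟨_, v, hv, hK.ne_zero hv, rfl⟩
  · rw [hK.chartSlice_projCone]
    exact hK.isHilbertHyperbolic_iff.2 hthin

theorem preimage (hK : IsSharpCone K f) (T : (Fin 3 → ℝ) ≃ₗ[ℝ] (Fin 3 → ℝ)) :
    IsSharpCone (T ⁻¹' K) (f ∘ₗ T.toLinearMap) where
  isOpen := hK.isOpen.preimage T.toLinearMap.continuous_of_finiteDimensional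
  convex := hK.convex.linear_preimage T.toLinearMap
  nonempty := hK.nonempty.preimage T.surjective
  smul_mem c hc v hv := by
    rw [Set.mem_preimage, map_smul]
    exact hK.smul_mem c hc _ hv
  pos v hv := hK.pos _ hv
  pos_closure v hv hv0 := by
    have hT : closure (T ⁻¹' K) = T ⁻¹' closure K :=
      (T.toContinuousLinearEquiv.toHomeomorph.preimage_closure K).symm
    rw [hT] at hv
    exact hK.pos_closure _ hv (by simpa using hv0)

end IsSharpCone

/-- A properly convex domain is the projectivization of a sharp cone. -/
theorem IsConvexChart.exists_isSharpCone {ω : Set P2} {f : Module.Dual ℝ (Fin 3 → ℝ)}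
    (hf : IsConvexChart ω f) (ho : IsOpen ω) (hne : ω.Nonempty) :
    ∃ K, IsSharpCone K f ∧ ω = projCone K := by
  -- Since `f` has no zeros on `ω`, its sign selects one of the two opposite rays of each line.
  set K : Set (Fin 3 → ℝ) := {v | 0 < f v ∧ ∃ hv : v ≠ 0, Projectivization.mk ℝ v hv ∈ ω}
  have hfne : ∀ {v : Fin 3 → ℝ} (hv : v ≠ 0), Projectivization.mk ℝ v hv ∈ closure ω → f v ≠ 0 :=
    fun hv h => (apply_rep_mk_ne_zero hv).1 (hf.avoids _ h)
  have hscale : ∀ (c : ℝ) {v : Fin 3 → ℝ} (hv : v ≠ 0) (hcv : c • v ≠ 0),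
      (Projectivization.mk ℝ (c • v) hcv : P2) = Projectivization.mk ℝ v hv := fun c v hv hcv =>
    (Projectivization.mk_eq_mk_iff' ..).2 ⟨c, rfl⟩
  have hω : ω = projCone K := by
    ext p
    constructor
    · intro hp
      induction p using Projectivization.ind with | h v hv =>
      rcases lt_or_gt_of_ne (hfne hv (subset_closure hp)) with h | h
      · refine ⟨-v, ⟨by simpa using h, neg_ne_zero.2 hv, ?_⟩, neg_ne_zero.2 hv, ?_⟩
        · convert hp using 1
          exact (Projectivization.mk_eq_mk_iff' ..).2 ⟨-1, by simp⟩
        · exact (Projectivization.mk_eq_mk_iff' ..).2 ⟨-1, by simp⟩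
      · exact ⟨v, ⟨h, hv, hp⟩, hv, rfl⟩
    · rintro ⟨v, ⟨_, _, hv⟩, _, rfl⟩
      exact hv
  have hsmul : ∀ c : ℝ, 0 < c → ∀ v ∈ K, c • v ∈ K := by
    rintro c hc v ⟨h1, h2, h3⟩
    refine ⟨by rw [map_smul]; exact mul_pos hc h1, smul_ne_zero hc.ne' h2, ?_⟩
    rwa [hscale c h2]
  have hKs : ∀ v ∈ K, (f v)⁻¹ • v ∈ chartSlice ω f := fun v hv =>
    ⟨by rw [map_smul, smul_eq_mul, inv_mul_cancel₀ hv.1.ne'],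
      (hsmul _ (inv_pos.2 hv.1) v hv).2⟩
  have hsK : ∀ v ∈ chartSlice ω f, v ∈ K := fun v hv => ⟨hv.1 ▸ one_pos, hv.2⟩
  have hpc : ∀ v ∈ closure K, v ≠ 0 → 0 < f v := by
    intro v hv hv0
    have h1 : 0 ≤ f v := closure_minimal (fun v hv => hv.1.le)
      (isClosed_le continuous_const f.continuous_of_finiteDimensional) hv
    obtain ⟨w, hw, hlim⟩ := mem_closure_iff_seq_limit.1 hv
    have h2 := mem_closure_of_tendsto
      (tendsto_projectivization_mk (fun n => (hw n).2.1) hv0 hlim)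
      (.of_forall fun n => (hw n).2.2)
    exact lt_of_le_of_ne h1 (hfne hv0 h2).symm
  refine ⟨K, ⟨?_, ?_, ?_, hsmul, fun v hv => hv.1, hpc⟩, hω⟩
  · have h1 : IsOpen {v : {v : Fin 3 → ℝ // v ≠ 0} |
        0 < f v.1 ∧ Projectivization.mk ℝ v.1 v.2 ∈ ω} :=
      (isOpen_lt continuous_const
        (f.continuous_of_finiteDimensional.comp continuous_subtype_val)).inter
        (ho.preimage continuous_projectivization_mk)
    have h2 := (isOpen_ne (x := (0 : Fin 3 → ℝ))).isOpenMap_subtype_val _ h1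
    have h3 : K = Subtype.val '' {v : {v : Fin 3 → ℝ // v ≠ 0} |
        0 < f v.1 ∧ Projectivization.mk ℝ v.1 v.2 ∈ ω} := by
      ext v
      constructor
      · rintro ⟨h1, h2, h3⟩
        exact ⟨⟨v, h2⟩, ⟨h1, h3⟩, rfl⟩
      · rintro ⟨⟨v, h2⟩, ⟨h1, h3⟩, rfl⟩
        exact ⟨h1, h2, h3⟩
    rw [h3]
    exact h2
  · intro x hx y hy a b ha hb hab
    -- Convexity is known only in the slice, so the combination is divided by its value under `f`.
    have hs : 0 < a * f x + b * f y := by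
      have h1 := hx.1
      have h2 := hy.1
      rcases ha.eq_or_lt with rfl | ha
      · rw [zero_add] at hab; subst hab; simpa using h2
      · positivity
    have h1 := hf.convex (hKs x hx) (hKs y hy) (a := a * f x / (a * f x + b * f y))
      (b := b * f y / (a * f x + b * f y)) (by have := hx.1; positivity)
      (by have := hy.1; positivity) (by field_simp)
    convert hsmul _ hs _ (hsK _ h1) using 1
    have h2 := hx.1.ne'
    have h3 := hy.1.ne'
    match_scalars <;> field_simp
  · obtain ⟨p, hp⟩ := hne
    rw [hω] at hp
    obtain ⟨v, hv, -⟩ := hp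
    exact ⟨v, hv⟩

theorem exists_isThinCone_of_mem_hyperbolicDomains {ω : Set P2} {δ : ℝ}
    (h : ω ∈ hyperbolicDomains δ) :
    ∃ K f, IsSharpCone K f ∧ IsThinCone (Real.exp (2 * δ)) K ∧ ω = projCone K := by
  obtain ⟨⟨ho, hne, -⟩, f, hf, hhyp⟩ := h
  obtain ⟨K, hK, rfl⟩ := hf.exists_isSharpCone ho hne
  refine ⟨K, f, hK, ?_, rfl⟩
  rwa [hK.chartSlice_projCone, hK.isHilbertHyperbolic_iff] at hhyp

theorem exists_linearEquiv_of_PGL (g : PGL(3, ℝ)) : ∃ T : (Fin 3 → ℝ) ≃ₗ[ℝ] (Fin 3 → ℝ),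
    ∀ (v : Fin 3 → ℝ) (hv : v ≠ 0), g • (Projectivization.mk ℝ v hv : P2) =
      Projectivization.mk ℝ (T v) (T.map_ne_zero_iff.2 hv) := by
  induction g using Matrix.ProjGenLinGroup.induction_on with | mk g =>
  exact ⟨DistribMulAction.toLinearEquiv ℝ (Fin 3 → ℝ) g, fun v hv => rfl⟩

theorem exists_PGL_of_linearEquiv (T : (Fin 3 → ℝ) ≃ₗ[ℝ] (Fin 3 → ℝ)) : ∃ g : PGL(3, ℝ),
    ∀ (v : Fin 3 → ℝ) (hv : v ≠ 0), g • (Projectivization.mk ℝ v hv : P2) =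
      Projectivization.mk ℝ (T v) (T.map_ne_zero_iff.2 hv) := by
  let M : GL (Fin 3) ℝ := Matrix.GeneralLinearGroup.toLin.symm
    (LinearMap.GeneralLinearGroup.ofLinearEquiv T)
  refine ⟨Matrix.ProjGenLinGroup.mk M, fun v hv => ?_⟩
  rw [Projectivization.PGL.mk_smul_mk]
  congr 1
  have : Matrix.toLin' M.1 = T.toLinearMap := Matrix.toLin'_toMatrix' T.toLinearMap
  change M.1.mulVec v = T v
  rw [← Matrix.toLin'_apply, this]
  rfl

theorem smul_projCone {g : PGL(3, ℝ)} {T : (Fin 3 → ℝ) ≃ₗ[ℝ] (Fin 3 → ℝ)}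
    (h : ∀ (v : Fin 3 → ℝ) (hv : v ≠ 0), g • (Projectivization.mk ℝ v hv : P2) =
      Projectivization.mk ℝ (T v) (T.map_ne_zero_iff.2 hv)) (K : Set (Fin 3 → ℝ)) :
    g • projCone K = projCone (T.symm ⁻¹' K) := by
  ext p
  constructor
  · rintro ⟨_, ⟨v, hv, hv0, rfl⟩, rfl⟩
    exact ⟨T v, by simpa using hv, T.map_ne_zero_iff.2 hv0, h v hv0⟩
  · rintro ⟨v, hv, hv0, rfl⟩
    refine ⟨_, ⟨T.symm v, hv, T.symm.map_ne_zero_iff.2 hv0, rfl⟩, ?_⟩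
    simp only [h, LinearEquiv.apply_symm_apply]

/-- Thinness refers to the linear structure only; the chart is transported along with the cone. -/
theorem smul_mem_hyperbolicDomains (g : PGL(3, ℝ)) {ω : Set P2} {δ : ℝ}
    (h : ω ∈ hyperbolicDomains δ) : g • ω ∈ hyperbolicDomains δ := by
  obtain ⟨K, f, hK, hthin, rfl⟩ := exists_isThinCone_of_mem_hyperbolicDomains h
  obtain ⟨T, hT⟩ := exists_linearEquiv_of_PGL g
  rw [smul_projCone hT]
  exact (hK.preimage T.symm).projCone_mem_hyperbolicDomains (hthin.preimage T.symm)

end ProjectivePlane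

/-! ### Tangent lines and the normal position -/

section NormalPosition

theorem vec_ne_zero (a b : ℝ) : (![a, b, 1] : Fin 3 → ℝ) ≠ 0 := fun h => by
  simpa using congrFun h 2

/-- The projective line through two distinct points on which the nonzero functional `φ` vanishes is
the zero locus of `φ`. -/
theorem mk_mem_lineThrough_iff {u w : Fin 3 → ℝ} (hu : u ≠ 0) (hw : w ≠ 0)
    (hne : (Projectivization.mk ℝ u hu : P2) ≠ Projectivization.mk ℝ w hw)
    {φ : Module.Dual ℝ (Fin 3 → ℝ)} (hφ : φ ≠ 0) (hφu : φ u = 0) (hφw : φ w = 0)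
    {v : Fin 3 → ℝ} (hv : v ≠ 0) :
    (Projectivization.mk ℝ v hv : P2) ∈
      lineThrough (Projectivization.mk ℝ u hu) (Projectivization.mk ℝ w hw) ↔ φ v = 0 := by
  have hli : LinearIndependent ℝ ![u, w] := by
    rw [LinearIndependent.pair_iff' hu]
    intro c hc
    exact hne ((Projectivization.mk_eq_mk_iff' ..).2 ⟨c, hc⟩).symm
  have hspan : Submodule.span ℝ {u} ⊔ Submodule.span ℝ {w} = LinearMap.ker φ := by
    refine Submodule.eq_of_le_of_finrank_eq ?_ ?_
    · rw [sup_le_iff, Submodule.span_singleton_le_iff_mem, Submodule.span_singleton_le_iff_mem]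
      exact ⟨hφu, hφw⟩
    · have h1 := Module.Dual.finrank_ker_add_one_of_ne_zero hφ
      have h2 := finrank_span_eq_card hli
      rw [Matrix.range_cons, Matrix.range_cons, Matrix.range_empty, Set.union_empty,
        Submodule.span_union] at h2
      rw [h2]
      simp only [Module.finrank_fintype_fun_eq_card, Fintype.card_fin] at h1 ⊢
      omega
  change (Projectivization.mk ℝ v hv).submodule ≤ _ ↔ _
  rw [Projectivization.submodule_mk, Projectivization.submodule_mk, Projectivization.submodule_mk,
    hspan, Submodule.span_singleton_le_iff_mem, LinearMap.mem_ker]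

theorem exists_functional_of_two_points (u w : Fin 3 → ℝ) :
    ∃ φ : Module.Dual ℝ (Fin 3 → ℝ), φ ≠ 0 ∧ φ u = 0 ∧ φ w = 0 := by
  have hlt : Submodule.span ℝ {u, w} < ⊤ := by
    rw [lt_top_iff_ne_top]
    intro h
    have h1 := finrank_span_le_card (R := ℝ) ({u, w} : Set (Fin 3 → ℝ))
    rw [h, finrank_top, Module.finrank_fintype_fun_eq_card, Fintype.card_fin] at h1
    have h2 : ({u, w} : Set (Fin 3 → ℝ)).toFinset.card ≤ 2 := by
      rw [Set.toFinset_insert, Set.toFinset_singleton]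
      exact Finset.card_le_two
    omega
  obtain ⟨φ, hφ, hle⟩ := Submodule.exists_le_ker_of_lt_top _ hlt
  exact ⟨φ, hφ, hle (Submodule.subset_span (by simp)), hle (Submodule.subset_span (by simp))⟩

namespace IsSharpCone

variable {K : Set (Fin 3 → ℝ)} {f : Module.Dual ℝ (Fin 3 → ℝ)}

/-- A functional without zeros on the cone has constant sign. -/
theorem pos_or_neg (hK : IsSharpCone K f) {φ : Module.Dual ℝ (Fin 3 → ℝ)}
    (h : ∀ v ∈ K, φ v ≠ 0) : (∀ v ∈ K, 0 < φ v) ∨ ∀ v ∈ K, 0 < (-φ) v := by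
  by_contra! hcon
  obtain ⟨⟨v, hv, hφv⟩, w, hw, hφw⟩ := hcon
  rw [LinearMap.neg_apply, neg_nonpos] at hφw
  have hv' : 0 < -φ v := neg_pos.2 (lt_of_le_of_ne hφv (h v hv))
  have hw' := lt_of_le_of_ne hφw (h w hw).symm
  refine h _ (hK.add_mem' (hK.smul_mem _ hw' v hv) (subset_closure (hK.smul_mem _ hv' w hw))) ?_
  simp
  ring

/-- A line that misses the domain is the zero locus of a functional of constant sign on the cone, so
uniqueness of the tangent is the smoothness statement `exists_eq_smul`. -/
theorem isTangentAt (hK : IsSharpCone K f) {R : ℝ} (hthin : IsThinCone R K)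
    {φ : Module.Dual ℝ (Fin 3 → ℝ)} (hφ : ∀ v ∈ K, 0 < φ v) {u : Fin 3 → ℝ} (hu : u ∈ closure K)
    (hu0 : u ≠ 0) (hφu : φ u = 0) {ℓ : Set P2}
    (hℓ : ∀ (v : Fin 3 → ℝ) (hv : v ≠ 0), Projectivization.mk ℝ v hv ∈ ℓ ↔ φ v = 0) :
    IsTangentAt (projCone K) ℓ (Projectivization.mk ℝ u hu0) where
  mem_frontier := by
    rw [hK.mk_mem_frontier hu0 (hK.pos_closure u hu hu0)]
    exact ⟨hu, fun h => (hφ u h).ne' hφu⟩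
  mem_line := (hℓ u hu0).2 hφu
  disjoint := by
    rw [Set.disjoint_right]
    rintro _ ⟨v, hv, hv0, rfl⟩ h
    exact (hφ v hv).ne' ((hℓ v hv0).1 h)
  unique := by
    intro q hq hdis
    induction q using Projectivization.ind with | h w hw =>
    obtain ⟨ψ, hψ, hψu, hψw⟩ := exists_functional_of_two_points u w
    have hline := fun (v : Fin 3 → ℝ) (hv : v ≠ 0) =>
      mk_mem_lineThrough_iff hu0 hw hq.symm hψ hψu hψw hv
    have hψK : ∀ v ∈ K, ψ v ≠ 0 := fun v hv h0 => Set.disjoint_left.1 hdis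
      ((hline v (hK.ne_zero hv)).2 h0) ⟨v, hv, hK.ne_zero hv, rfl⟩
    obtain ⟨c, hc⟩ : ∃ c : ℝ, ψ = c • φ := by
      rcases hK.pos_or_neg hψK with h | h
      · exact hK.exists_eq_smul (by simp) hthin hu hu0 hφ h hφu hψu
      · obtain ⟨c, hc⟩ := hK.exists_eq_smul (by simp) hthin hu hu0 hφ h hφu (by simp [hψu])
        exact ⟨-c, by rw [← neg_neg ψ, hc]; ext; simp⟩
    have hc0 : c ≠ 0 := by
      rintro rfl
      exact hψ (by rw [hc, zero_smul])
    ext r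
    induction r using Projectivization.ind with | h v hv =>
    rw [hline v hv, hℓ v hv, hc, LinearMap.smul_apply, smul_eq_mul]
    simp [hc0]

end IsSharpCone

/-- The functional on `ℝ³` whose zero locus is the line through `(1 / α, 0)` and
`(0, 1 / (1 - α))`. -/
noncomputable def diagonalFunctional (α : ℝ) : Module.Dual ℝ (Fin 3 → ℝ) :=
  LinearMap.proj 2 - α • LinearMap.proj 0 - (1 - α) • LinearMap.proj 1

theorem diagonalFunctional_apply (α : ℝ) (v : Fin 3 → ℝ) :
    diagonalFunctional α v = v 2 - α * v 0 - (1 - α) * v 1 := rfl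

theorem affinePoint_ne {a b c d : ℝ} (h : a ≠ c ∨ b ≠ d) : affinePoint a b ≠ affinePoint c d := by
  intro heq
  obtain ⟨t, ht⟩ := (Projectivization.mk_eq_mk_iff' ..).1 heq
  have h2 : t = 1 := by simpa using congrFun ht 2
  subst h2
  have h0 : c = a := by simpa using congrFun ht 0
  have h1 : d = b := by simpa using congrFun ht 1
  exact h.elim (fun h => h h0.symm) (fun h => h h1.symm)

theorem mk_mem_first_axis (v : Fin 3 → ℝ) (hv : v ≠ 0) : (Projectivization.mk ℝ v hv : P2) ∈
    lineThrough (affinePoint 0 0) (affinePoint 1 0) ↔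
      (LinearMap.proj 1 : Module.Dual ℝ (Fin 3 → ℝ)) v = 0 :=
  mk_mem_lineThrough_iff (vec_ne_zero 0 0) (vec_ne_zero 1 0) (affinePoint_ne (by simp))
    (fun h => by simpa using LinearMap.congr_fun h ![0, 1, 0]) (by simp) (by simp) hv

theorem mk_mem_second_axis (v : Fin 3 → ℝ) (hv : v ≠ 0) : (Projectivization.mk ℝ v hv : P2) ∈
    lineThrough (affinePoint 0 0) (affinePoint 0 1) ↔
      (LinearMap.proj 0 : Module.Dual ℝ (Fin 3 → ℝ)) v = 0 :=
  mk_mem_lineThrough_iff (vec_ne_zero 0 0) (vec_ne_zero 0 1) (affinePoint_ne (by simp))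
    (fun h => by simpa using LinearMap.congr_fun h ![1, 0, 0]) (by simp) (by simp) hv

theorem mk_mem_diagonal {α : ℝ} (h0 : 0 < α) (h1 : α < 1) (v : Fin 3 → ℝ) (hv : v ≠ 0) :
    (Projectivization.mk ℝ v hv : P2) ∈
      lineThrough (affinePoint (1 / α) 0) (affinePoint 0 (1 / (1 - α))) ↔
        diagonalFunctional α v = 0 := by
  have h1' : 1 - α ≠ 0 := (sub_pos.2 h1).ne'
  refine mk_mem_lineThrough_iff (vec_ne_zero _ 0) (vec_ne_zero 0 _)
    (affinePoint_ne (Or.inl (by positivity))) (fun h => ?_) ?_ ?_ hv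
  · simpa [diagonalFunctional_apply] using LinearMap.congr_fun h ![0, 0, 1]
  · simp [diagonalFunctional_apply, h0.ne']
  · simp [diagonalFunctional_apply, h1']

/-- A cone in normal position: the conditions of `IsNormalPosition` on the level of cones. -/
structure IsNormalCone (K : Set (Fin 3 → ℝ)) (α : ℝ) : Prop where
  fst_nonneg : ∀ v ∈ K, 0 ≤ v 0
  snd_nonneg : ∀ v ∈ K, 0 ≤ v 1
  diag_pos : ∀ v ∈ K, 0 < diagonalFunctional α v
  fst_mem : ![1, 0, 1] ∈ closure K
  snd_mem : ![0, 1, 1] ∈ closure K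
  diag_mem : ![1, 1, 1] ∈ closure K

theorem IsSharpCone.isNormalPosition {K : Set (Fin 3 → ℝ)} {f : Module.Dual ℝ (Fin 3 → ℝ)} {R α : ℝ}
    (hK : IsSharpCone K f) (hthin : IsThinCone R K) (hN : IsNormalCone K α) (h0 : 0 < α)
    (h1 : α < 1) (hpos0 : ∀ v ∈ K, 0 < v 0) (hpos1 : ∀ v ∈ K, 0 < v 1) {x y z : P2}
    (hxyz : ({x, y, z} : Set P2) = {affinePoint 1 0, affinePoint 0 1, affinePoint 1 1}) :
    IsNormalPosition (projCone K) x y z α where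
  vertices := hxyz
  quadrant := by
    rintro _ ⟨v, hv, hv0, rfl⟩
    have hd := hN.diag_pos v hv
    have p0 := hpos0 v hv
    have p1 := hpos1 v hv
    have h1' := sub_pos.2 h1
    rw [diagonalFunctional_apply] at hd
    have hv2 : 0 < v 2 := by
      have : 0 < α * v 0 + (1 - α) * v 1 := by positivity
      linarith
    refine ⟨v 0 / v 2, v 1 / v 2, by positivity, by positivity, ?_⟩
    refine (Projectivization.mk_eq_mk_iff' ..).2 ⟨v 2, ?_⟩
    ext i
    fin_cases i <;> simp [mul_div_cancel₀, hv2.ne']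
  tangent_fst := hK.isTangentAt hthin (φ := LinearMap.proj 1) hpos1 hN.fst_mem (vec_ne_zero 1 0)
    (by simp) mk_mem_first_axis
  tangent_snd := hK.isTangentAt hthin (φ := LinearMap.proj 0) hpos0 hN.snd_mem (vec_ne_zero 0 1)
    (by simp) mk_mem_second_axis
  tangent_diag := hK.isTangentAt hthin (φ := diagonalFunctional α) hN.diag_pos hN.diag_mem
    (vec_ne_zero 1 1) (by simp [diagonalFunctional_apply]) (mk_mem_diagonal h0 h1)

/-- The first two coordinates have to be `ψ` and `φ`, scaled to be `1` at `w`, and the diagonal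
functional has to be a multiple of `χ`. Requiring that `u` and `v` go to the rays of `(1, 0, 1)` and
`(0, 1, 1)` then forces this multiple to be `1 / (r + s)` and `α = s / (r + s)`. The hypothesis
`hle` says `s ≤ r`, that is `α ≤ 1 / 2`. -/
theorem IsSharpCone.exists_normalization {K : Set (Fin 3 → ℝ)} {f : Module.Dual ℝ (Fin 3 → ℝ)}
    (hK : IsSharpCone K f) {u v w : Fin 3 → ℝ} (hu : u ∈ closure K) (hv : v ∈ closure K)
    (hw : w ∈ closure K) {φ ψ χ : Module.Dual ℝ (Fin 3 → ℝ)} (hφ : ∀ k ∈ K, 0 < φ k)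
    (hψ : ∀ k ∈ K, 0 < ψ k) (hχ : ∀ k ∈ K, 0 < χ k) (hφu : φ u = 0) (hψv : ψ v = 0)
    (hχw : χ w = 0) (hφv : 0 < φ v) (hφw : 0 < φ w) (hψu : 0 < ψ u) (hψw : 0 < ψ w)
    (hχu : 0 < χ u) (hχv : 0 < χ v) (hle : χ v * φ w * ψ u ≤ χ u * ψ w * φ v) :
    ∃ (T : (Fin 3 → ℝ) ≃ₗ[ℝ] (Fin 3 → ℝ)) (α : ℝ), 0 < α ∧ α ≤ 1 / 2 ∧
      IsNormalCone (T.symm ⁻¹' K) α ∧ (∀ k ∈ T.symm ⁻¹' K, 0 < k 0) ∧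
      (∀ k ∈ T.symm ⁻¹' K, 0 < k 1) ∧ ∃ a b c : ℝ,
        T u = a • ![1, 0, 1] ∧ T v = b • ![0, 1, 1] ∧ T w = c • ![1, 1, 1] := by
  set r := χ u * ψ w / ψ u with hr
  set s := χ v * φ w / φ v with hs
  have hr0 : 0 < r := by positivity
  have hs0 : 0 < s := by positivity
  have hsr : s ≤ r := by
    rw [hr, hs, div_le_div_iff₀ hφv hψu]
    exact hle
  set α := s / (r + s) with hα
  have h1α : 1 - α = r / (r + s) := by rw [hα]; field_simp; ring
  set S : (Fin 3 → ℝ) →ₗ[ℝ] (Fin 3 → ℝ) := LinearMap.pi ![(ψ w)⁻¹ • ψ, (φ w)⁻¹ • φ,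
    α • (ψ w)⁻¹ • ψ + (1 - α) • (φ w)⁻¹ • φ + (r + s)⁻¹ • χ] with hS
  have hS0 : ∀ k, S k 0 = (ψ w)⁻¹ * ψ k := fun k => rfl
  have hS1 : ∀ k, S k 1 = (φ w)⁻¹ * φ k := fun k => rfl
  have hS2 : ∀ k, S k 2 = α * ((ψ w)⁻¹ * ψ k) + (1 - α) * ((φ w)⁻¹ * φ k) + (r + s)⁻¹ * χ k :=
    fun k => rfl
  have hSu : S u = (ψ u / ψ w) • ![1, 0, 1] := by
    ext i
    fin_cases i
    · simp [hS0]; ring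
    · simp [hS1, hφu]
    · simp only [Fin.reduceFinMk, hS2, hφu, hα, hr, hs]
      simp
      field_simp
      ring
  have hSv : S v = (φ v / φ w) • ![0, 1, 1] := by
    ext i
    fin_cases i
    · simp [hS0, hψv]
    · simp [hS1]; ring
    · simp only [Fin.reduceFinMk, hS2, hψv, h1α]
      rw [hr, hs]
      simp
      field_simp
  have hSw : S w = (1 : ℝ) • ![1, 1, 1] := by
    ext i
    fin_cases i
    · simp [hS0, hψw.ne']
    · simp [hS1, hφw.ne']
    · simp [hS2, hχw, hψw.ne', hφw.ne']
  have hsurj : Function.Surjective S := by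
    intro e
    -- These are the coordinates of `e` in the basis `(1, 0, 1)`, `(0, 1, 1)`, `(1, 1, 1)`,
    -- corrected by the factors in `hSu` and `hSv`.
    refine ⟨((e 2 - e 1) * (ψ w / ψ u)) • u + ((e 2 - e 0) * (φ w / φ v)) • v +
      (e 0 + e 1 - e 2) • w, ?_⟩
    rw [map_add, map_add, map_smul, map_smul, map_smul, hSu, hSv, hSw]
    ext i
    fin_cases i <;> simp <;> field_simp <;> ring
  set T := LinearEquiv.ofBijective S ⟨LinearMap.injective_iff_surjective.2 hsurj, hsurj⟩ with hT
  have hTS : ∀ k, T k = S k := fun k => rfl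
  have hT' : ∀ k, S (T.symm k) = k := fun k => T.apply_symm_apply k
  have hcl : closure (T.symm ⁻¹' K) = T.symm ⁻¹' closure K :=
    (T.symm.toContinuousLinearEquiv.toHomeomorph.preimage_closure K).symm
  have hmem : ∀ (k e : Fin 3 → ℝ) (a : ℝ), 0 < a → k ∈ closure K → S k = a • e →
      e ∈ closure (T.symm ⁻¹' K) := by
    intro k e a ha hk h
    rw [hcl, Set.mem_preimage]
    have : T.symm e = a⁻¹ • k := by
      rw [LinearEquiv.symm_apply_eq, map_smul, hTS, h, inv_smul_smul₀ ha.ne']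
    rw [this]
    exact hK.smul_mem_closure (inv_nonneg.2 ha.le) hk
  have hp0 : ∀ k ∈ T.symm ⁻¹' K, 0 < k 0 := by
    intro k hk
    rw [← hT' k, hS0]
    exact mul_pos (inv_pos.2 hψw) (hψ _ hk)
  have hp1 : ∀ k ∈ T.symm ⁻¹' K, 0 < k 1 := by
    intro k hk
    rw [← hT' k, hS1]
    exact mul_pos (inv_pos.2 hφw) (hφ _ hk)
  refine ⟨T, α, by positivity, ?_, ⟨fun k hk => (hp0 k hk).le, fun k hk => (hp1 k hk).le, ?_,
    hmem u _ _ (by positivity) hu hSu, hmem v _ _ (by positivity) hv hSv,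
    hmem w _ _ one_pos hw hSw⟩, hp0, hp1, _, _, _, hSu, hSv, hSw⟩
  · rw [hα, div_le_iff₀ (by positivity)]
    linarith
  · intro k hk
    rw [diagonalFunctional_apply, ← hT' k, hS0, hS1, hS2]
    have := mul_pos (inv_pos.2 (add_pos hr0 hs0)) (hχ _ hk)
    linarith

/-- Every triangle-pointed hyperbolic domain can be moved to normal position. -/
theorem exists_isNormalPosition {δ : ℝ} {ω : Set P2} {x y z : P2}
    (hT : (ω, x, y, z) ∈ trianglePointed δ) : ∃ (g : PGL(3, ℝ)) (α : ℝ), 0 < α ∧ α ≤ 1 / 2 ∧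
      IsNormalPosition (g • ω) (g • x) (g • y) (g • z) α := by
  obtain ⟨hω, hx, hy, hz, hxy, hyz, hzx⟩ := hT
  obtain ⟨K, f, hK, hthin, rfl⟩ := exists_isThinCone_of_mem_hyperbolicDomains hω
  have hrep : ∀ p ∈ frontier (projCone K), ∃ (u : Fin 3 → ℝ) (hu : u ≠ 0),
      p = Projectivization.mk ℝ u hu ∧ u ∈ closure K ∧ f u = 1 ∧
        ∃ φ : Module.Dual ℝ (Fin 3 → ℝ), (∀ v ∈ K, 0 < φ v) ∧ φ u = 0 := by
    intro p hp
    have hp' : p ∈ projCone (closure K) := hK.closure_projCone ▸ frontier_subset_closure hp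
    obtain ⟨v, hv, hv0, rfl⟩ := hp'
    have hfv := hK.pos_closure v hv hv0
    have hvK := ((hK.mk_mem_frontier hv0 hfv).1 hp).2
    obtain ⟨φ, hφ, hφv⟩ := hK.exists_functional hvK
    have hφv' := le_antisymm hφv (IsSharpCone.nonneg_closure_of_pos hφ hv)
    exact ⟨(f v)⁻¹ • v, smul_ne_zero (inv_ne_zero hfv.ne') hv0,
      ((Projectivization.mk_eq_mk_iff' ..).2 ⟨_, rfl⟩ : _ = _).symm,
      hK.smul_mem_closure (inv_nonneg.2 hfv.le) hv,
      by rw [map_smul, smul_eq_mul, inv_mul_cancel₀ hfv.ne'], φ, hφ, by simp [hφv']⟩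
  obtain ⟨u, hu0, rfl, hu, hfu, φ, hφ, hφu⟩ := hrep x hx
  obtain ⟨v, hv0, rfl, hv, hfv, ψ, hψ, hψv⟩ := hrep y hy
  obtain ⟨w, hw0, rfl, hw, hfw, χ, hχ, hχw⟩ := hrep z hz
  -- By strict convexity a supporting functional at one vertex cannot vanish at another.
  have hpos : ∀ {φ : Module.Dual ℝ (Fin 3 → ℝ)} {u v : Fin 3 → ℝ}, (∀ k ∈ K, 0 < φ k) →
      u ∈ closure K → v ∈ closure K → f u = 1 → f v = 1 → φ u = 0 → u ≠ v → 0 < φ v :=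
    fun hφ hu hv hfu hfv h0 hne => lt_of_le_of_ne (IsSharpCone.nonneg_closure_of_pos hφ hv)
      fun h => hne (hK.eq_of_isThinCone hthin hφ hu hv hfu hfv h0 h.symm)
  have huv : u ≠ v := fun h => hxy (by subst h; rfl)
  have hvw : v ≠ w := fun h => hyz (by subst h; rfl)
  have hwu : w ≠ u := fun h => hzx (by subst h; rfl)
  have hφv := hpos hφ hu hv hfu hfv hφu huv
  have hφw := hpos hφ hu hw hfu hfw hφu hwu.symm
  have hψu := hpos hψ hv hu hfv hfu hψv huv.symm
  have hψw := hpos hψ hv hw hfv hfw hψv hvw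
  have hχu := hpos hχ hw hu hfw hfu hχw hwu
  have hχv := hpos hχ hw hv hfw hfv hχw hvw.symm
  have hmk : ∀ {g : PGL(3, ℝ)} {T : (Fin 3 → ℝ) ≃ₗ[ℝ] (Fin 3 → ℝ)},
      (∀ (v : Fin 3 → ℝ) (hv : v ≠ 0), g • (Projectivization.mk ℝ v hv : P2) =
        Projectivization.mk ℝ (T v) (T.map_ne_zero_iff.2 hv)) →
      ∀ {k : Fin 3 → ℝ} (hk : k ≠ 0) {c a b : ℝ}, T k = c • ![a, b, 1] →
        g • (Projectivization.mk ℝ k hk : P2) = affinePoint a b := by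
    intro g T hg k hk c a b h
    rw [hg]
    exact (Projectivization.mk_eq_mk_iff' ..).2 ⟨c, h.symm⟩
  -- In the second case the roles of `x` and `y` are exchanged, which replaces `α` by `1 - α`; the
  -- vertices are prescribed only as a set.
  rcases le_total (χ v * φ w * ψ u) (χ u * ψ w * φ v) with hle | hle
  · obtain ⟨T, α, h0, h1, hN, hp0, hp1, a, b, c, hTu, hTv, hTw⟩ :=
      hK.exists_normalization hu hv hw hφ hψ hχ hφu hψv hχw hφv hφw hψu hψw hχu hχv hle
    obtain ⟨g, hg⟩ := exists_PGL_of_linearEquiv T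
    refine ⟨g, α, h0, h1, ?_⟩
    rw [smul_projCone hg]
    refine (hK.preimage T.symm).isNormalPosition (hthin.preimage T.symm) hN h0 (by linarith)
      hp0 hp1 ?_
    rw [hmk hg hu0 hTu, hmk hg hv0 hTv, hmk hg hw0 hTw]
  · obtain ⟨T, α, h0, h1, hN, hp0, hp1, a, b, c, hTv, hTu, hTw⟩ :=
      hK.exists_normalization hv hu hw hψ hφ hχ hψv hφu hχw hψu hψw hφv hφw hχv hχu hle
    obtain ⟨g, hg⟩ := exists_PGL_of_linearEquiv T
    refine ⟨g, α, h0, h1, ?_⟩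
    rw [smul_projCone hg]
    refine (hK.preimage T.symm).isNormalPosition (hthin.preimage T.symm) hN h0 (by linarith)
      hp0 hp1 ?_
    rw [hmk hg hu0 hTu, hmk hg hv0 hTv, hmk hg hw0 hTw, Set.insert_comm]

/-- The cone over a hyperbolic domain in normal position. -/
theorem IsNormalPosition.exists_isNormalCone {δ : ℝ} {ω : Set P2} {x y z : P2} {α : ℝ}
    (h : IsNormalPosition ω x y z α) (hω : ω ∈ hyperbolicDomains δ) (h0 : 0 < α) (h1 : α < 1) :
    ∃ K f, IsSharpCone K f ∧ IsThinCone (Real.exp (2 * δ)) K ∧ ω = projCone K ∧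
      IsNormalCone K α := by
  -- the last coordinate has no zeros on `ω`, so that its sign on the cone can be chosen
  obtain ⟨K, f, hK, hthin, rfl, hZ⟩ : ∃ K f, IsSharpCone K f ∧
      IsThinCone (Real.exp (2 * δ)) K ∧ ω = projCone K ∧ ∀ v ∈ K, 0 < v 2 := by
    obtain ⟨K, f, hK, hthin, rfl⟩ := exists_isThinCone_of_mem_hyperbolicDomains hω
    have hne : ∀ v ∈ K, (LinearMap.proj 2 : Module.Dual ℝ (Fin 3 → ℝ)) v ≠ 0 := by
      intro v hv
      obtain ⟨a, b, -, -, hab⟩ := h.quadrant _ ⟨v, hv, hK.ne_zero hv, rfl⟩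
      obtain ⟨c, rfl⟩ := (Projectivization.mk_eq_mk_iff' ..).1 hab
      rintro h0
      have hc : c = 0 := by simpa using h0
      exact hK.ne_zero hv (by rw [hc, zero_smul])
    rcases hK.pos_or_neg hne with hpos | hneg
    · exact ⟨K, f, hK, hthin, rfl, hpos⟩
    · refine ⟨_, _, hK.preimage (LinearEquiv.neg ℝ), hthin.preimage (LinearEquiv.neg ℝ), ?_, ?_⟩
      · ext p
        constructor
        · rintro ⟨v, hv, hv0, rfl⟩
          exact ⟨-v, by simpa using hv, neg_ne_zero.2 hv0,
            (Projectivization.mk_eq_mk_iff' ..).2 ⟨-1, by simp⟩⟩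
        · rintro ⟨v, hv, hv0, rfl⟩
          exact ⟨-v, by simpa using hv, neg_ne_zero.2 hv0,
            (Projectivization.mk_eq_mk_iff' ..).2 ⟨-1, by simp⟩⟩
      · intro v hv
        simpa using hneg _ hv
  have hZc : ∀ v ∈ closure K, 0 ≤ v 2 := fun v hv =>
    IsSharpCone.nonneg_closure_of_pos (φ := LinearMap.proj 2) hZ hv
  have hcl : ∀ a b : ℝ, affinePoint a b ∈ frontier (projCone K) → ![a, b, 1] ∈ closure K := by
    intro a b hab
    have hab' : affinePoint a b ∈ projCone (closure K) :=
      hK.closure_projCone ▸ frontier_subset_closure hab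
    obtain ⟨v, hv, hv0, heq⟩ := hab'
    obtain ⟨c, hc⟩ := (Projectivization.mk_eq_mk_iff' ..).1 heq
    have h2 : c * v 2 = 1 := by simpa using congrFun hc 2
    have hcpos : 0 < c := pos_of_mul_pos_left (h2 ▸ one_pos) (hZc v hv)
    rw [← hc]
    exact hK.smul_mem_closure hcpos.le hv
  have hxc := hcl 1 0 h.tangent_fst.mem_frontier
  have hyc := hcl 0 1 h.tangent_snd.mem_frontier
  have hzc := hcl 1 1 h.tangent_diag.mem_frontier
  have hquad : ∀ v ∈ K, 0 ≤ v 0 ∧ 0 ≤ v 1 := by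
    intro v hv
    obtain ⟨a, b, ha, hb, hab⟩ := h.quadrant _ ⟨v, hv, hK.ne_zero hv, rfl⟩
    obtain ⟨c, rfl⟩ := (Projectivization.mk_eq_mk_iff' ..).1 hab
    have hc : 0 < c := by simpa using hZ _ hv
    exact ⟨by simpa using mul_nonneg hc.le ha, by simpa using mul_nonneg hc.le hb⟩
  refine ⟨K, f, hK, hthin, rfl, fun v hv => (hquad v hv).1, fun v hv => (hquad v hv).2, ?_, hxc,
    hyc, hzc⟩
  have hne : ∀ v ∈ K, diagonalFunctional α v ≠ 0 := fun v hv h0' =>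
    Set.disjoint_left.1 h.tangent_diag.disjoint ((mk_mem_diagonal h0 h1 v (hK.ne_zero hv)).2 h0')
      ⟨v, hv, hK.ne_zero hv, rfl⟩
  -- The sign is decided at `![1, 0, 1]`, where the diagonal functional equals `1 - α > 0`.
  rcases hK.pos_or_neg hne with hpos | hneg
  · exact hpos
  · have := IsSharpCone.nonneg_closure_of_pos hneg hxc
    rw [LinearMap.neg_apply, diagonalFunctional_apply] at this
    simp at this
    linarith

end NormalPosition

/-! ### Compactness of the cones in normal position -/

section Selection

/-- A nonzero linear functional that is nonnegative on an open set is positive on it. -/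
theorem pos_of_nonneg_of_isOpen {V : Type*} [NormedAddCommGroup V] [NormedSpace ℝ V] {U : Set V}
    (hU : IsOpen U) {φ : Module.Dual ℝ V} (hφ : φ ≠ 0) (h : ∀ v ∈ U, 0 ≤ φ v) {v : V}
    (hv : v ∈ U) : 0 < φ v := by
  refine lt_of_le_of_ne (h v hv) fun h0 => hφ ?_
  ext e
  have hev : ∀ e : V, 0 ≤ φ e := by
    intro e
    have : ∀ᶠ t : ℝ in 𝓝[>] 0, v + t • e ∈ U := by
      have h : Tendsto (fun t : ℝ => v + t • e) (𝓝 0) (𝓝 (v + (0 : ℝ) • e)) :=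
        (by fun_prop : Continuous fun t : ℝ => v + t • e).tendsto 0
      rw [zero_smul, add_zero] at h
      exact (h.mono_left nhdsWithin_le_nhds) (hU.mem_nhds hv)
    obtain ⟨t, ht, ht0⟩ := (this.and self_mem_nhdsWithin).exists
    have := h _ ht
    rw [map_add, map_smul, ← h0, zero_add, smul_eq_mul] at this
    exact nonneg_of_mul_nonneg_right this ht0
  have h1 := hev (-e)
  rw [map_neg, neg_nonneg] at h1
  exact le_antisymm h1 (hev e)

/-- The functional `(a, b, c) ↦ a + c`; cones in normal position are bounded in its chart. -/
noncomputable def sumFunctional : Module.Dual ℝ (Fin 3 → ℝ) :=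
  (LinearMap.proj 0 : Module.Dual ℝ (Fin 3 → ℝ)) + LinearMap.proj 2

theorem sumFunctional_apply (v : Fin 3 → ℝ) : sumFunctional v = v 0 + v 2 := rfl

/-- A closed cone that contains all cones in normal position with parameter at most `1 / 2`. -/
def normalCone : Set (Fin 3 → ℝ) := {v | 0 ≤ v 0 ∧ 0 ≤ v 1 ∧ v 1 ≤ 2 * v 2}

theorem isClosed_normalCone : IsClosed normalCone :=
  (isClosed_le continuous_const (continuous_apply 0)).inter
    ((isClosed_le continuous_const (continuous_apply 1)).inter
      (isClosed_le (continuous_apply 1) (continuous_const.mul (continuous_apply 2))))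

theorem sumFunctional_pos {v : Fin 3 → ℝ} (hv : v ∈ normalCone) (hv0 : v ≠ 0) :
    0 < sumFunctional v := by
  obtain ⟨h0, h1, h2⟩ := hv
  rw [sumFunctional_apply]
  by_contra! h
  refine hv0 ?_
  ext i
  fin_cases i <;> simp <;> linarith

theorem isCompact_normalCone_slice : IsCompact {v | sumFunctional v = 1 ∧ v ∈ normalCone} := by
  refine (isCompact_closedBall (0 : Fin 3 → ℝ) 2).of_isClosed_subset
    ((isClosed_eq sumFunctional.continuous_of_finiteDimensional continuous_const).inter
      isClosed_normalCone) ?_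
  rintro v ⟨h, h0, h1, h2⟩
  rw [sumFunctional_apply] at h
  rw [mem_closedBall_zero_iff, pi_norm_le_iff_of_nonneg (by norm_num)]
  intro i
  rw [Real.norm_eq_abs, abs_le]
  fin_cases i <;> simp <;> constructor <;> linarith

/-- On `K` one has `v 2 > α * v 0 + (1 - α) * v 1 ≥ v 1 / 2`. No positive lower bound on `α` is
needed, so the compactness argument remains available when `α` tends to `0`. -/
theorem IsNormalCone.closure_subset {K : Set (Fin 3 → ℝ)} {α : ℝ} (hN : IsNormalCone K α)
    (h0 : 0 ≤ α) (h1 : α ≤ 1 / 2) : closure K ⊆ normalCone := by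
  refine closure_minimal (fun v hv => ?_) isClosed_normalCone
  have a0 := hN.fst_nonneg v hv
  have a1 := hN.snd_nonneg v hv
  have a2 := hN.diag_pos v hv
  rw [diagonalFunctional_apply] at a2
  refine ⟨a0, a1, ?_⟩
  nlinarith [mul_nonneg h0 a0, mul_nonneg (sub_nonneg.2 h1) a1]

/-- The union of the lines in a closed subset of the projective plane is closed. -/
theorem isClosed_zero_or_mk_mem {A : Set P2} (hA : IsClosed A) :
    IsClosed {v : Fin 3 → ℝ | v = 0 ∨ ∃ hv : v ≠ 0, Projectivization.mk ℝ v hv ∈ A} := by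
  rw [← isOpen_compl_iff]
  have h := (isOpen_ne (x := (0 : Fin 3 → ℝ))).isOpenMap_subtype_val _
    (hA.isOpen_compl.preimage continuous_projectivization_mk)
  convert h using 1
  ext v
  constructor
  · intro hv
    have hv0 : v ≠ 0 := fun h => hv (Or.inl h)
    exact ⟨⟨v, hv0⟩, fun h => hv (Or.inr ⟨hv0, h⟩), rfl⟩
  · rintro ⟨⟨v, hv0⟩, hv, rfl⟩ (h | ⟨_, h⟩)
    · exact hv0 h
    · exact hv h

/-- Together with the next lemma this turns Hausdorff convergence into statements about sequences of
points. -/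
theorem exists_tendsto_mem_of_hausdorffDist {X : Type*} [MetricSpace X] [CompactSpace X]
    {s : ℕ → Set X} {A : Set X} (hs : ∀ k, (s k).Nonempty)
    (h : Tendsto (fun k => Metric.hausdorffDist (s k) A) atTop (𝓝 0)) {p : X} (hp : p ∈ A) :
    ∃ q : ℕ → X, (∀ k, q k ∈ s k) ∧ Tendsto q atTop (𝓝 p) := by
  have key : ∀ k, ∃ q ∈ s k, dist p q < Metric.hausdorffDist (s k) A + 1 / ((k : ℝ) + 1) := by
    intro k
    rw [← Metric.infDist_lt_iff (hs k)]
    have hfin : Metric.hausdorffEDist A (s k) ≠ ⊤ :=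
      Metric.hausdorffEDist_ne_top_of_nonempty_of_bounded ⟨p, hp⟩ (hs k)
        (isCompact_univ.isBounded.subset (Set.subset_univ _))
        (isCompact_univ.isBounded.subset (Set.subset_univ _))
    have := Metric.infDist_le_hausdorffDist_of_mem hp hfin
    rw [Metric.hausdorffDist_comm] at this
    have h2 : 0 < 1 / ((k : ℝ) + 1) := Nat.one_div_pos_of_nat
    linarith
  choose q hq hd using key
  refine ⟨q, hq, tendsto_iff_dist_tendsto_zero.2 ?_⟩
  refine squeeze_zero (fun k => dist_nonneg) (fun k => (dist_comm (q k) p).le.trans (hd k).le) ?_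
  simpa using h.add tendsto_one_div_add_atTop_nhds_zero_nat

theorem mem_of_tendsto_hausdorffDist {X : Type*} [MetricSpace X] [CompactSpace X]
    {s : ℕ → Set X} {A : Set X} (hA : IsClosed A) (hne : A.Nonempty)
    (h : Tendsto (fun k => Metric.hausdorffDist (s k) A) atTop (𝓝 0)) {q : ℕ → X} {p : X}
    (hq : ∀ k, q k ∈ s k) (hp : Tendsto q atTop (𝓝 p)) : p ∈ A := by
  rw [hA.mem_iff_infDist_zero hne]
  refine tendsto_nhds_unique (((Metric.continuous_infDist_pt A).tendsto p).comp hp) ?_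
  refine squeeze_zero (fun k => Metric.infDist_nonneg) (fun k => ?_) h
  exact Metric.infDist_le_hausdorffDist_of_mem (hq k)
    (Metric.hausdorffEDist_ne_top_of_nonempty_of_bounded ⟨_, hq k⟩ hne
      (isCompact_univ.isBounded.subset (Set.subset_univ _))
      (isCompact_univ.isBounded.subset (Set.subset_univ _)))

/-- Blaschke selection: the nonempty compact subsets of a compact space form a compact space, and
closures do not change Hausdorff distances. -/
theorem exists_subseq_hausdorffDist {X : Type*} [MetricSpace X] [CompactSpace X]
    (s : ℕ → Set X) (hs : ∀ k, (s k).Nonempty) : ∃ (A : Set X) (φ : ℕ → ℕ), IsClosed A ∧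
      A.Nonempty ∧ StrictMono φ ∧
        Tendsto (fun k => Metric.hausdorffDist (s (φ k)) A) atTop (𝓝 0) := by
  let S : ℕ → TopologicalSpace.NonemptyCompacts X := fun k =>
    ⟨⟨closure (s k), isClosed_closure.isCompact⟩, (hs k).closure⟩
  obtain ⟨A, φ, hφ, h⟩ := CompactSpace.tendsto_subseq S
  refine ⟨A, φ, A.isCompact.isClosed, A.nonempty, hφ, ?_⟩
  have h1 := tendsto_iff_dist_tendsto_zero.1 h
  refine h1.congr fun k => ?_
  rw [Function.comp_apply, Metric.NonemptyCompacts.dist_eq]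
  exact Metric.hausdorffDist_closure₁

/-- A point in the interior of the limit of a sequence of convex cones lies in almost all of
them. -/
theorem eventually_mem_of_mem_interior {V : Type*} [NormedAddCommGroup V] [NormedSpace ℝ V]
    [FiniteDimensional ℝ V] {K : ℕ → Set V} {f : ℕ → Module.Dual ℝ V}
    (hK : ∀ n, IsSharpCone (K n) (f n)) {C : Set V}
    (hC : ∀ v ∈ C, ∃ w : ℕ → V, (∀ n, w n ∈ closure (K n)) ∧ Tendsto w atTop (𝓝 v)) {v : V}
    (hv : v ∈ interior C) : ∀ᶠ n in atTop, v ∈ K n := by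
  by_contra hcon
  obtain ⟨ψ, hψ, hvψ⟩ := extraction_of_frequently_atTop (not_eventually.1 hcon)
  -- Functionals separating `v` from the cones that miss it, scaled to norm one, accumulate at a
  -- nonzero `G` which is nonnegative on `C` but not positive at the interior point `v`.
  have key : ∀ j, ∃ g ∈ Metric.sphere (0 : V →L[ℝ] ℝ) 1,
      (∀ w ∈ closure (K (ψ j)), 0 ≤ g w) ∧ g v ≤ 0 := by
    intro j
    obtain ⟨χ, hχ, hχv⟩ := (hK (ψ j)).exists_functional (hvψ j)
    set g := LinearMap.toContinuousLinearMap χ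
    have hg0 : 0 < ‖g‖ := by
      rw [norm_pos_iff]
      intro h0
      obtain ⟨w, hw⟩ := (hK (ψ j)).nonempty
      have h1 : g w = χ w := rfl
      rw [h0] at h1
      exact (hχ w hw).ne h1
    refine ⟨‖g‖⁻¹ • g, by simp [norm_smul, hg0.ne'], fun w hw => ?_, ?_⟩
    · exact mul_nonneg (inv_nonneg.2 hg0.le) (IsSharpCone.nonneg_closure_of_pos hχ hw)
    · exact mul_nonpos_of_nonneg_of_nonpos (inv_nonneg.2 hg0.le) hχv
  choose g hg hgK hgv using key
  obtain ⟨G, hG, θ, hθ, hlim⟩ := (isCompact_sphere (0 : V →L[ℝ] ℝ) 1).tendsto_subseq hg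
  have happ : ∀ (ws : ℕ → V) (w : V), Tendsto ws atTop (𝓝 w) →
      Tendsto (fun j => g (θ j) (ws j)) atTop (𝓝 (G w)) := fun ws w hw =>
    (isBoundedBilinearMap_apply.continuous.tendsto (G, w)).comp (hlim.prodMk_nhds hw)
  have hGC : ∀ w ∈ C, 0 ≤ G w := by
    intro w hw
    obtain ⟨ws, hws, hwlim⟩ := hC w hw
    have hw' : Tendsto (fun j => ws (ψ (θ j))) atTop (𝓝 w) :=
      hwlim.comp (hψ.comp hθ).tendsto_atTop
    exact ge_of_tendsto' (happ _ _ hw') fun j => hgK _ _ (hws _)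
  have hGv : G v ≤ 0 := le_of_tendsto' (happ _ _ tendsto_const_nhds) fun j => hgv _
  have hG0 : G.toLinearMap ≠ 0 := by
    intro h0
    have : G = 0 := by
      ext w
      exact LinearMap.congr_fun h0 w
    simp [this] at hG
  exact absurd (pos_of_nonneg_of_isOpen isOpen_interior hG0
    (fun w hw => hGC w (interior_subset hw)) hv) (not_lt.2 hGv)

/-- A sequence of thin cones in normal position, with parameters at most `1 / 2`, has a subsequence
that converges to a thin sharp cone. -/
theorem exists_subseq_thinCone {R : ℝ} {K : ℕ → Set (Fin 3 → ℝ)}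
    {f : ℕ → Module.Dual ℝ (Fin 3 → ℝ)} {α : ℕ → ℝ} (hK : ∀ n, IsSharpCone (K n) (f n))
    (hthin : ∀ n, IsThinCone R (K n)) (hN : ∀ n, IsNormalCone (K n) (α n)) (h0 : ∀ n, 0 < α n)
    (h1 : ∀ n, α n ≤ 1 / 2) :
    ∃ (φ : ℕ → ℕ) (L : Set (Fin 3 → ℝ)), StrictMono φ ∧ IsSharpCone L sumFunctional ∧
      IsThinCone R L ∧ (∀ v ∈ L, ∀ᶠ k in atTop, v ∈ K (φ k)) ∧
      (![1, 0, 1] ∈ closure L ∧ ![1, 0, 1] ∉ L) ∧ (![0, 1, 1] ∈ closure L ∧ ![0, 1, 1] ∉ L) ∧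
      (![1, 1, 1] ∈ closure L ∧ ![1, 1, 1] ∉ L) ∧
      Tendsto (fun k => Metric.hausdorffDist (projCone (K (φ k))) (projCone L)) atTop (𝓝 0) := by
  have hne : ∀ n, (projCone (K n)).Nonempty := fun n => by
    obtain ⟨v, hv⟩ := (hK n).nonempty
    exact ⟨_, v, hv, (hK n).ne_zero hv, rfl⟩
  obtain ⟨A, φ, hA, hAne, hφ, hlim⟩ := exists_subseq_hausdorffDist _ hne
  have hKD : ∀ n, closure (K n) ⊆ normalCone := fun n =>
    (hN n).closure_subset (h0 n).le (h1 n)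
  have hclim : Tendsto (fun k => Metric.hausdorffDist (closure (projCone (K (φ k)))) A)
      atTop (𝓝 0) := hlim.congr fun k => Metric.hausdorffDist_closure₁.symm
  -- The cone over the limit set `A`, with `normalCone` fixing the choice between opposite rays. By
  -- `lower` and `upper` it is the limit of the closed cones.
  set C : Set (Fin 3 → ℝ) := {v | v ∈ normalCone ∧
    (v = 0 ∨ ∃ hv : v ≠ 0, Projectivization.mk ℝ v hv ∈ A)}
  have hCclosed : IsClosed C := isClosed_normalCone.inter (isClosed_zero_or_mk_mem hA)
  have lower : ∀ v ∈ C, ∃ w : ℕ → Fin 3 → ℝ, (∀ k, w k ∈ closure (K (φ k))) ∧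
      Tendsto w atTop (𝓝 v) := by
    rintro v ⟨hvD, rfl | ⟨hv0, hvA⟩⟩
    · exact ⟨fun _ => 0, fun k => (hK _).zero_mem_closure, tendsto_const_nhds⟩
    · obtain ⟨q, hq, hqlim⟩ := exists_tendsto_mem_of_hausdorffDist (fun k => hne (φ k)) hlim hvA
      have hF := sumFunctional_pos hvD hv0
      refine ⟨fun k => sumFunctional v • chartSection sumFunctional (q k), fun k => ?_, ?_⟩
      · obtain ⟨w, hw, hw0, hqw⟩ := hq k
        have hFw := sumFunctional_pos (hKD _ (subset_closure hw)) hw0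
        simp only
        rw [hqw, chartSection_mk _ hw0 hFw.ne', smul_smul]
        exact subset_closure ((hK _).smul_mem _ (by positivity) w hw)
      · have := (tendsto_chartSection_mk hF.ne' hqlim).const_smul (sumFunctional v)
        rwa [smul_inv_smul₀ hF.ne'] at this
  have upper : ∀ (ψ : ℕ → ℕ) (v : ℕ → Fin 3 → ℝ) (w : Fin 3 → ℝ), StrictMono ψ →
      (∀ k, v k ∈ closure (K (φ (ψ k)))) → Tendsto v atTop (𝓝 w) → w ∈ C := by
    intro ψ v w hψ hv hw
    refine ⟨isClosed_normalCone.mem_of_tendsto hw (.of_forall fun k => hKD _ (hv k)), ?_⟩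
    rcases eq_or_ne w 0 with hw0 | hw0
    · exact Or.inl hw0
    · obtain ⟨N, hN'⟩ := eventually_atTop.1 (hw.eventually_ne hw0)
      have hN0 : ∀ k, v (k + N) ≠ 0 := fun k => hN' _ (Nat.le_add_left _ _)
      refine Or.inr ⟨hw0, mem_of_tendsto_hausdorffDist hA hAne
        (s := fun k => closure (projCone (K (φ (ψ (k + N))))))
        (hclim.comp (hψ.tendsto_atTop.comp (tendsto_add_atTop_nat N)))
        (q := fun k => Projectivization.mk ℝ (v (k + N)) (hN0 k)) (fun k => ?_)
        (tendsto_projectivization_mk hN0 hw0 (hw.comp (tendsto_add_atTop_nat N)))⟩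
      rw [(hK _).closure_projCone]
      exact ⟨_, hv _, hN0 k, rfl⟩
  have hCadd : ∀ u ∈ C, ∀ v ∈ C, ∀ a b : ℝ, 0 ≤ a → 0 ≤ b → a • u + b • v ∈ C := by
    intro u hu v hv a b ha hb
    obtain ⟨us, hus, hulim⟩ := lower u hu
    obtain ⟨vs, hvs, hvlim⟩ := lower v hv
    exact upper id _ _ strictMono_id (fun k => (hK _).add_mem_closure
      ((hK _).smul_mem_closure ha (hus k)) ((hK _).smul_mem_closure hb (hvs k)))
      ((hulim.const_smul a).add (hvlim.const_smul b))
  have hCconv : Convex ℝ C := fun u hu v hv a b ha hb _ => hCadd u hu v hv a b ha hb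
  have hx : ![1, 0, 1] ∈ C := upper id _ _ strictMono_id (fun k => (hN _).fst_mem)
    tendsto_const_nhds
  have hy : ![0, 1, 1] ∈ C := upper id _ _ strictMono_id (fun k => (hN _).snd_mem)
    tendsto_const_nhds
  have hz : ![1, 1, 1] ∈ C := upper id _ _ strictMono_id (fun k => (hN _).diag_mem)
    tendsto_const_nhds
  have hint : (interior C).Nonempty := by
    -- The sum of the three vertices, an interior point of the cone they span.
    refine ⟨![2, 2, 3], ?_⟩
    have hopen : IsOpen {e : Fin 3 → ℝ | e 1 < e 2 ∧ e 0 < e 2 ∧ e 2 < e 0 + e 1} :=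
      (isOpen_lt (continuous_apply 1) (continuous_apply 2)).inter
        ((isOpen_lt (continuous_apply 0) (continuous_apply 2)).inter
          (isOpen_lt (continuous_apply 2) ((continuous_apply 0).add (continuous_apply 1))))
    refine interior_maximal ?_ hopen ?_
    · rintro e ⟨e1, e2, e3⟩
      have h := hCadd _ (hCadd _ hx _ hy (e 2 - e 1) (e 2 - e 0) (by linarith) (by linarith)) _ hz
        1 (e 0 + e 1 - e 2) zero_le_one (by linarith)
      convert h using 1
      ext i
      fin_cases i <;> simp
      ring
    · simp
      norm_num
  set L := interior C with hL
  have hcl : closure L = C := by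
    rw [hL, hCconv.closure_interior_eq_closure_of_nonempty_interior hint, hCclosed.closure_eq]
  have hF0 : sumFunctional ≠ 0 := fun h => by
    simpa [sumFunctional_apply] using LinearMap.congr_fun h ![0, 0, 1]
  have hFC : ∀ v ∈ C, v ≠ 0 → 0 < sumFunctional v := fun v hv => sumFunctional_pos hv.1
  have hFL : ∀ v ∈ L, 0 < sumFunctional v := fun v hv =>
    pos_of_nonneg_of_isOpen isOpen_interior hF0 (fun w hw => by
      rcases eq_or_ne w 0 with rfl | hw0
      · simp
      · exact (hFC w (interior_subset hw) hw0).le) hv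
  have hsharp : IsSharpCone L sumFunctional := by
    refine ⟨isOpen_interior, hCconv.interior, hint, fun c hc v hv => ?_, hFL, by rwa [hcl]⟩
    have hopen : IsOpen {w : Fin 3 → ℝ | c⁻¹ • w ∈ interior C} :=
      isOpen_interior.preimage (continuous_const_smul c⁻¹)
    refine interior_maximal (fun w hw => ?_) hopen ?_
    · have hw : c⁻¹ • w ∈ C := interior_subset hw
      simpa [hc.ne'] using hCadd _ hw _ hw c 0 hc.le le_rfl
    · simpa [hc.ne'] using hv
  have hev : ∀ v ∈ L, ∀ᶠ k in atTop, v ∈ K (φ k) := fun v hv =>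
    eventually_mem_of_mem_interior (fun k => hK (φ k)) lower hv
  have hpos : ∀ i : Fin 3, (∀ v ∈ C, 0 ≤ v i) → ∀ v ∈ L, 0 < v i := by
    intro i hi v hv
    exact pos_of_nonneg_of_isOpen (φ := (LinearMap.proj i : Module.Dual ℝ (Fin 3 → ℝ)))
      isOpen_interior (fun h => by simpa using LinearMap.congr_fun h 1)
      (fun w hw => hi w (interior_subset hw)) hv
  refine ⟨φ, L, hφ, hsharp, ?_, hev, ⟨hcl ▸ hx, fun h => ?_⟩, ⟨hcl ▸ hy, fun h => ?_⟩,
    ⟨hcl ▸ hz, fun h => ?_⟩, ?_⟩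
  · refine IsThinCone.of_limit (K := fun k => K (φ k)) (f := sumFunctional) (fun k v hv => ?_)
      (fun k => hthin _) hFL hev (by rwa [hcl])
    rcases eq_or_ne v 0 with rfl | hv0
    · simp
    · exact (sumFunctional_pos (hKD _ hv) hv0).le
  · simpa using hpos 1 (fun v hv => hv.1.2.1) _ h
  · simpa using hpos 0 (fun v hv => hv.1.1) _ h
  -- Otherwise `![1, 1, 1]` would lie in some `K (φ k)`, although its diagonal functional vanishes
  -- there.
  · obtain ⟨k, hk⟩ := (hev _ h).exists
    simpa [diagonalFunctional_apply] using (hN _).diag_pos _ hk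
  -- A point of `A` is a limit of points of the domains; their normalized representatives lie in a
  -- compact slice, and a limit of these represents it in `C`.
  · have hAL : closure (projCone L) = A := by
      rw [hsharp.closure_projCone, hcl]
      refine Set.Subset.antisymm ?_ fun p hp => ?_
      · rintro _ ⟨v, ⟨-, h | ⟨_, h⟩⟩, hv0, rfl⟩
        · exact absurd h hv0
        · exact h
      · obtain ⟨q, hq, hqlim⟩ := exists_tendsto_mem_of_hausdorffDist (fun k => hne (φ k)) hlim hp
        choose v hv hv0 hqv using hq
        have hFv := fun k => sumFunctional_pos (hKD _ (subset_closure (hv k))) (hv0 k)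
        have hmem : ∀ k, (sumFunctional (v k))⁻¹ • v k ∈
            {v | sumFunctional v = 1 ∧ v ∈ normalCone} := fun k =>
          ⟨by rw [map_smul, smul_eq_mul, inv_mul_cancel₀ (hFv k).ne'],
            hKD _ (subset_closure ((hK _).smul_mem _ (inv_pos.2 (hFv k)) _ (hv k)))⟩
        obtain ⟨w, ⟨hw1, hwD⟩, θ, hθ, hwlim⟩ := isCompact_normalCone_slice.tendsto_subseq hmem
        have hw0 : w ≠ 0 := by
          rintro rfl
          simp at hw1
        have hpw : p = Projectivization.mk ℝ w hw0 := by
          refine tendsto_nhds_unique (hqlim.comp hθ.tendsto_atTop) ?_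
          refine (tendsto_projectivization_mk
            (fun k => smul_ne_zero (inv_ne_zero (hFv (θ k)).ne') (hv0 (θ k))) hw0 hwlim).congr
            fun k => ?_
          rw [Function.comp_apply, hqv]
          exact (Projectivization.mk_eq_mk_iff' ..).2 ⟨_, rfl⟩
        exact ⟨w, ⟨hwD, Or.inr ⟨hw0, hpw ▸ hp⟩⟩, hw0, hpw⟩
    refine hlim.congr fun k => ?_
    rw [← hAL, Metric.hausdorffDist_closure₂]

/-- The parameters of thin cones in normal position are bounded away from zero. -/
theorem exists_parameter_bound {R : ℝ} {K : ℕ → Set (Fin 3 → ℝ)}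
    {f : ℕ → Module.Dual ℝ (Fin 3 → ℝ)} {α : ℕ → ℝ} (hK : ∀ n, IsSharpCone (K n) (f n))
    (hthin : ∀ n, IsThinCone R (K n)) (hN : ∀ n, IsNormalCone (K n) (α n)) (h0 : ∀ n, 0 < α n)
    (h1 : ∀ n, α n ≤ 1 / 2) : ∃ e : ℝ, 0 < e ∧ ∀ n, e ≤ α n := by
  by_contra! hcon
  -- The indices `m k` need not increase: only the convergence of `α (m k)` to `0` matters.
  choose m hm using fun k : ℕ => hcon (1 / ((k : ℝ) + 1)) Nat.one_div_pos_of_nat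
  obtain ⟨φ, L, hφ, hL, hLthin, hev, -, ⟨hy, -⟩, ⟨hz, -⟩, -⟩ :=
    exists_subseq_thinCone (fun k => hK (m k)) (fun k => hthin (m k)) (fun k => hN (m k))
      (fun k => h0 (m k)) (fun k => h1 (m k))
  have hα : Tendsto (fun k => α (m (φ k))) atTop (𝓝 0) :=
    (squeeze_zero (fun k => (h0 (m k)).le) (fun k => (hm k).le)
      tendsto_one_div_add_atTop_nhds_zero_nat).comp hφ.tendsto_atTop
  -- In the limit the diagonal functional becomes `v 2 - v 1`. It supports `L` and vanishes at both
  -- `![0, 1, 1]` and `![1, 1, 1]`, which strict convexity forbids.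
  have hd0 : diagonalFunctional 0 ≠ 0 := fun h => by
    simpa [diagonalFunctional_apply] using LinearMap.congr_fun h ![0, 0, 1]
  have hd : ∀ v ∈ L, 0 < diagonalFunctional 0 v := fun v hv =>
    pos_of_nonneg_of_isOpen hL.isOpen hd0 (fun w hw => by
      have hlim : Tendsto (fun k => diagonalFunctional (α (m (φ k))) w) atTop
          (𝓝 (diagonalFunctional 0 w)) := by
        simp only [diagonalFunctional_apply]
        exact ((tendsto_const_nhds.sub (hα.mul_const _)).sub
          ((tendsto_const_nhds.sub hα).mul_const _))
      exact ge_of_tendsto hlim ((hev w hw).mono fun k hk => ((hN _).diag_pos w hk).le)) hv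
  have heq := hL.eq_of_isThinCone hLthin hd hy
    -- The factor `1 / 2` normalizes `![1, 1, 1]`, on which `sumFunctional` is `2`.
    (hL.smul_mem_closure (by norm_num : (0 : ℝ) ≤ 1 / 2) hz) (by simp [sumFunctional_apply])
    (by simp [sumFunctional_apply]; norm_num) (by simp [diagonalFunctional_apply])
    (by simp [diagonalFunctional_apply])
  have := congrFun heq 0
  norm_num at this

/-- A sequence of hyperbolic domains in normal position, with parameters at most `1 / 2`, has a
subsequence that converges to a hyperbolic domain through the three vertices. -/
theorem exists_subseq_trianglePointed {δ : ℝ} {ω : ℕ → Set P2} {x y z : ℕ → P2} {α : ℕ → ℝ}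
    (hω : ∀ n, ω n ∈ hyperbolicDomains δ)
    (hN : ∀ n, IsNormalPosition (ω n) (x n) (y n) (z n) (α n)) (h0 : ∀ n, 0 < α n)
    (h1 : ∀ n, α n ≤ 1 / 2) :
    ∃ (φ : ℕ → ℕ) (Ω : Set P2), StrictMono φ ∧
      (Ω, affinePoint 1 0, affinePoint 0 1, affinePoint 1 1) ∈ trianglePointed δ ∧
      Tendsto (fun k => Metric.hausdorffDist (ω (φ k)) Ω) atTop (𝓝 0) := by
  choose K f hK hthin hωK hKN using fun n =>
    (hN n).exists_isNormalCone (hω n) (h0 n) ((h1 n).trans_lt (by norm_num))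
  obtain ⟨φ, L, hφ, hL, hLthin, -, hx, hy, hz, hlim⟩ :=
    exists_subseq_thinCone hK hthin hKN h0 h1
  refine ⟨φ, projCone L, hφ, ⟨hL.projCone_mem_hyperbolicDomains hLthin,
    (hL.mk_mem_frontier (vec_ne_zero 1 0) ?_).2 hx, (hL.mk_mem_frontier (vec_ne_zero 0 1) ?_).2 hy,
    (hL.mk_mem_frontier (vec_ne_zero 1 1) ?_).2 hz, affinePoint_ne (by simp),
    affinePoint_ne (by simp), affinePoint_ne (by simp)⟩, ?_⟩
  · simp [sumFunctional_apply]
  · simp [sumFunctional_apply]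
  · simp [sumFunctional_apply]
  · exact hlim.congr fun k => by rw [hωK]

end Selection

/-- A sequence of triples whose underlying sets are equal to a fixed set of three points has a
subsequence that converges to such a triple. -/
theorem exists_subseq_triple {X : Type*} [TopologicalSpace X] [FirstCountableTopology X]
    {a b c : X} (hab : a ≠ b) (hbc : b ≠ c) (hca : c ≠ a) {x y z : ℕ → X}
    (h : ∀ n, ({x n, y n, z n} : Set X) = {a, b, c}) :
    ∃ (φ : ℕ → ℕ) (p q r : X), StrictMono φ ∧ (p ≠ q ∧ q ≠ r ∧ r ≠ p) ∧
      ({p, q, r} : Set X) = {a, b, c} ∧ Tendsto (x ∘ φ) atTop (𝓝 p) ∧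
      Tendsto (y ∘ φ) atTop (𝓝 q) ∧ Tendsto (z ∘ φ) atTop (𝓝 r) := by
  -- Only finitely many triples have this underlying set, so they form a compact set.
  set S : Set (X × X × X) := {t | ({t.1, t.2.1, t.2.2} : Set X) = {a, b, c}} with hS
  have hfin : S.Finite := by
    have h3 : ({a, b, c} : Set X).Finite := Set.toFinite _
    refine (h3.prod (h3.prod h3)).subset ?_
    rintro ⟨p, q, r⟩ ht
    have ht : ({p, q, r} : Set X) = {a, b, c} := ht
    rw [← ht]
    exact ⟨by simp, by simp, by simp⟩
  obtain ⟨⟨p, q, r⟩, ht, φ, hφ, hlim⟩ := hfin.isCompact.tendsto_subseq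
    (x := fun n => (x n, y n, z n)) h
  have ht : ({p, q, r} : Set X) = {a, b, c} := ht
  refine ⟨φ, p, q, r, hφ, ?_, ht, ?_, ?_, ?_⟩
  · have h3 : ({a, b, c} : Set X).ncard = 3 := Set.ncard_eq_three.2
      ⟨a, b, c, hab, hca.symm, hbc, rfl⟩
    rw [← ht] at h3
    refine ⟨?_, ?_, ?_⟩ <;> rintro rfl
    · rw [Set.insert_eq_of_mem (by simp)] at h3
      have := Set.ncard_insert_le p {r}
      rw [Set.ncard_singleton] at this
      omega
    · rw [Set.pair_eq_singleton] at h3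
      have := Set.ncard_insert_le p {q}
      rw [Set.ncard_singleton] at this
      omega
    · rw [Set.insert_eq_of_mem (by simp)] at h3
      have := Set.ncard_insert_le q {r}
      rw [Set.ncard_singleton] at this
      omega
  · exact (continuous_fst.tendsto _).comp hlim
  · exact ((continuous_fst.comp continuous_snd).tendsto _).comp hlim
  · exact ((continuous_snd.comp continuous_snd).tendsto _).comp hlim

/-! ### Assembly of the three assertions -/

theorem mainTheorem5 (δ : ℝ) (hδ : 0 < δ) (ω : ℕ → Set P2) (x y z : ℕ → P2)
    (hT : ∀ n, (ω n, x n, y n, z n) ∈ trianglePointed δ) :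
    -- cocompactness of the action of `PGL(3, ℝ)`
    (∃ (g : ℕ → PGL(3, ℝ)) (φ : ℕ → ℕ) (Ω : Set P2) (X Y Z : P2),
      StrictMono φ ∧ (Ω, X, Y, Z) ∈ trianglePointed δ ∧
      Tendsto (fun k => Metric.hausdorffDist (g (φ k) • ω (φ k)) Ω) atTop (𝓝 0) ∧
      Tendsto (fun k => g (φ k) • x (φ k)) atTop (𝓝 X) ∧
      Tendsto (fun k => g (φ k) • y (φ k)) atTop (𝓝 Y) ∧
      Tendsto (fun k => g (φ k) • z (φ k)) atTop (𝓝 Z)) ∧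
    -- normalization of the sequence
    (∃ (g : ℕ → PGL(3, ℝ)) (e : ℝ), 0 < e ∧ e ≤ 1 / 2 ∧
      ∀ n, ∃ α : ℝ, e ≤ α ∧ α ≤ 1 / 2 ∧
        IsNormalPosition (g n • ω n) (g n • x n) (g n • y n) (g n • z n) α) ∧
    -- convergence of a subsequence of every normalized sequence
    (∀ (g : ℕ → PGL(3, ℝ)) (e : ℝ), 0 < e → e ≤ 1 / 2 →
      (∀ n, ∃ α : ℝ, e ≤ α ∧ α ≤ 1 / 2 ∧
        IsNormalPosition (g n • ω n) (g n • x n) (g n • y n) (g n • z n) α) →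
      ∃ (φ : ℕ → ℕ) (Ω : Set P2), StrictMono φ ∧
        (Ω, affinePoint 1 0, affinePoint 0 1, affinePoint 1 1) ∈ trianglePointed δ ∧
        Tendsto (fun k => Metric.hausdorffDist (g (φ k) • ω (φ k)) Ω) atTop (𝓝 0)) := by
  have hω : ∀ (g : ℕ → PGL(3, ℝ)) n, g n • ω n ∈ hyperbolicDomains δ := fun g n =>
    smul_mem_hyperbolicDomains (g n) (hT n).1
  have hconv : ∀ (g : ℕ → PGL(3, ℝ)) (e : ℝ), 0 < e → e ≤ 1 / 2 →
      (∀ n, ∃ α : ℝ, e ≤ α ∧ α ≤ 1 / 2 ∧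
        IsNormalPosition (g n • ω n) (g n • x n) (g n • y n) (g n • z n) α) →
      ∃ (φ : ℕ → ℕ) (Ω : Set P2), StrictMono φ ∧
        (Ω, affinePoint 1 0, affinePoint 0 1, affinePoint 1 1) ∈ trianglePointed δ ∧
        Tendsto (fun k => Metric.hausdorffDist (g (φ k) • ω (φ k)) Ω) atTop (𝓝 0) := by
    intro g e he _ h
    choose α hα hα' hN using h
    exact exists_subseq_trianglePointed (hω g) hN (fun n => he.trans_le (hα n)) hα'
  have hnorm : ∃ (g : ℕ → PGL(3, ℝ)) (e : ℝ), 0 < e ∧ e ≤ 1 / 2 ∧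
      ∀ n, ∃ α : ℝ, e ≤ α ∧ α ≤ 1 / 2 ∧
        IsNormalPosition (g n • ω n) (g n • x n) (g n • y n) (g n • z n) α := by
    -- Each domain is normalized separately; the common bound `e` then comes from compactness.
    choose g α hα hα' hN using fun n => exists_isNormalPosition (hT n)
    choose K f hK hthin _ hKN using fun n =>
      (hN n).exists_isNormalCone (hω g n) (hα n) ((hα' n).trans_lt (by norm_num))
    obtain ⟨e, he, hle⟩ := exists_parameter_bound hK hthin hKN hα hα'
    exact ⟨g, e, he, (hle 0).trans (hα' 0), fun n => ⟨α n, hle n, hα' n, hN n⟩⟩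
  refine ⟨?_, hnorm, hconv⟩
  obtain ⟨g, e, he, he', hN⟩ := hnorm
  obtain ⟨φ, Ω, hφ, hΩ, hlim⟩ := hconv g e he he' hN
  obtain ⟨hΩh, hp, hq, hr, hpq, hqr, hrp⟩ := hΩ
  have hvert : ∀ n, ({g n • x n, g n • y n, g n • z n} : Set P2) =
      {affinePoint 1 0, affinePoint 0 1, affinePoint 1 1} := fun n => by
    obtain ⟨α, -, -, h⟩ := hN n
    exact h.vertices
  -- The order of the vertices may vary with the index, so a further subsequence is taken along
  -- which the ordered triples converge.
  obtain ⟨ψ, X, Y, Z, hψ, ⟨hXY, hYZ, hZX⟩, hXYZ, hX, hY, hZ⟩ :=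
    exists_subseq_triple hpq hqr hrp (fun k => hvert (φ k))
  have hfr : ({X, Y, Z} : Set P2) ⊆ frontier Ω := by
    rw [hXYZ]
    rintro _ (rfl | rfl | rfl)
    exacts [hp, hq, hr]
  exact ⟨g, φ ∘ ψ, Ω, X, Y, Z, hφ.comp hψ, ⟨hΩh, hfr (by simp), hfr (by simp), hfr (by simp), hXY,
    hYZ, hZX⟩, hlim.comp hψ.tendsto_atTop, hX, hY, hZ⟩
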